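/- Let $\mathcal A$ be a finite alphabet and let $\Xi\subseteq\mathcal A^{\mathbb Z}$ be a nonempty subset that is closed (for the product topology) and invariant under the shift $(\sigma u)_n=u_{n+1}$ and its inverse. Call $\Xi$ *minimal* if it contains no proper nonempty closed shift-invariant subset. *Tiling spaces and plasticity.* For positive lengths $\ell=(\ell_a)_{a\in\mathcal A}$ let $\Omega_\ell$ be the quotient of $\Xi\times\mathbb R$ by the equivalence relation generated by $(u,t)\sim(\sigma(u),t-\ell_{u_0})$, with the $\mathbb R$-action $s\cdot[u,t]=[u,t+s]$. This is the space of tilings of the line by intervals with labels in $\mathcal A$, with the translation action (the origin being moved by $s$): a tile with label $a$ has length $\ell_a$, the sequence of labels is a sequence of $\Xi$, and in $[u,t]$ the tile labelled $u_0$ occupies $[-t,-t+\ell_{u_0}]$. $\Xi$ is *plastic* if for all positive length vectors $\ell,\ell'$ there are a number $c>0$ and a homeomorphism $\Omega_\ell\to\Omega_{c\ell'}$ that commutes with the $\mathbb R$-actions. A *finite recoding* of $\Xi$ is a sequence space over a finite alphabet obtained from $\Xi$ by finitely many steps, each of which is one of the following or the inverse of one of the following: (i) relabelling each letter according to a rule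 that depends only on the letters within a fixed distance of it, in such a way that the resulting map of sequences is injective (e.g. collaring); (ii) dividing each letter $a$ into $p_a\ge 1$ consecutive letters, with different labels for different pieces (the inverse step amalgamates tiles). $\Xi$ is *totally plastic* if every finite recoding of $\Xi$ is plastic. *Balance.* Let $\mathcal L$ be the set of finite words appearing in sequences of $\Xi$. For a word $w$ and $n>0$ let $m_w(n)$ and $M_w(n)$ be the minimum and maximum number of occurrences of $w$ in a word of length $n$ of $\mathcal L$. $\mathcal L$ is *finitely balanced* if there is a constant $C$ with $M_a(n)-m_a(n)<C$ for all letters $a$ and all $n>0$. $\mathcal L$ is *totally finitely balanced* if for every $w\in\mathcal L$ there is a constant $C_w$ with $M_w(n)-m_w(n)<C_w$ for all $n>0$. **Theorem.** If $\Xi$ is plastic, then $\mathcal L$ is finitely balanced; if $\Xi$ is totally plastic, then $\mathcal L$ is totally finitely balanced. If $\Xi$ is minimal, the converses hold as well: $\Xi$ is plastic if and only if $\mathcal L$ is finitely balanced, and $\Xi$ is totally plastic if and only if $\mathcal L$ is totally finitely balanced. -/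

import Mathlib

open SymbolicDynamics.FullShift

universe u

/-- A space of bi-infinite sequences: a nonempty, closed, shift-invariant set of functions
`ℤ → A` over a finite (discrete) alphabet `A`. -/
structure SequenceSpace where
  /-- the alphabet -/
  Alphabet : Type u
  [top : TopologicalSpace Alphabet]
  [discrete : DiscreteTopology Alphabet]
  [finite : Finite Alphabet]
  /-- the underlying closed shift-invariant set of sequences -/
  toSubshift : Subshift Alphabet ℤ
  nonempty : toSubshift.carrier.Nonempty

namespace SequenceSpace

attribute [instance] SequenceSpace.top SequenceSpace.discrete SequenceSpace.finite

/-- The set of sequences belonging to the space. -/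
def seqs (X : SequenceSpace.{u}) : Set (ℤ → X.Alphabet) := X.toSubshift.carrier

/-- The shift `σ`, `(σ u) n = u (n + 1)`, as a self-map of the space. -/
def sigma (X : SequenceSpace.{u}) (x : X.seqs) : X.seqs :=
  ⟨shift 1 x.1, X.toSubshift.mapsTo 1 x.2⟩

/-- A sequence space is minimal if it contains no smaller nonempty closed shift-invariant set. -/
def IsMinimal (X : SequenceSpace.{u}) : Prop :=
  ∀ Z : Subshift X.Alphabet ℤ, Z.carrier.Nonempty → Z.carrier ⊆ X.seqs → Z.carrier = X.seqs

/-! ### Language and balance -/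

/-- The language: all finite words appearing within sequences of the space. -/
def language (X : SequenceSpace.{u}) : Set (List X.Alphabet) :=
  {w | ∃ x ∈ X.seqs, ∃ (k : ℤ) (n : ℕ), w = (List.range n).map fun i : ℕ => x (k + i)}

open Classical in
/-- The number of occurrences of the word `w` in the word `v`, i.e. the number of positions `i`
such that `w` can be read in `v` starting at position `i`. -/
noncomputable def occurrences {A : Type u} (w v : List A) : ℕ :=
  ((Finset.range (v.length + 1)).filter fun i => w <+: v.drop i).card

/-- The minimum number of occurrences of `w` in a word of length `n` of the language. -/
noncomputable def minOcc (X : SequenceSpace.{u}) (w : List X.Alphabet) (n : ℕ) : ℕ :=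
  sInf {k | ∃ v ∈ X.language, v.length = n ∧ occurrences w v = k}

/-- The maximum number of occurrences of `w` in a word of length `n` of the language.
(The set is nonempty and bounded by `n + 1`.) -/
noncomputable def maxOcc (X : SequenceSpace.{u}) (w : List X.Alphabet) (n : ℕ) : ℕ :=
  sSup {k | ∃ v ∈ X.language, v.length = n ∧ occurrences w v = k}

/-- The language is finitely balanced: the number of occurrences of each letter in words of
length `n` varies by a bounded amount. -/
def FinitelyBalanced (X : SequenceSpace.{u}) : Prop :=
  ∃ C : ℤ, ∀ (a : X.Alphabet) (n : ℕ), 0 < n → (X.maxOcc [a] n : ℤ) - X.minOcc [a] n < C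

/-- The language is totally finitely balanced: the same for every word `w` of the language. -/
def TotallyFinitelyBalanced (X : SequenceSpace.{u}) : Prop :=
  ∀ w ∈ X.language, ∃ C : ℤ, ∀ n : ℕ, 0 < n → (X.maxOcc w n : ℤ) - X.minOcc w n < C

/-! ### Tiling spaces -/

/-- The gluing `(x, t) ∼ (σ x, t - ℓ (x 0))`. -/
def Glue (X : SequenceSpace.{u}) (ℓ : X.Alphabet → ℝ) (p q : X.seqs × ℝ) : Prop :=
  q = (X.sigma p.1, p.2 - ℓ (p.1.1 0))

/-- The tiling space `Ω_ℓ`: the suspension of the sequence space by the length function `ℓ`, i.e.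
the quotient of `X × ℝ` (with the quotient topology) by the equivalence relation generated by
`Glue`. The class of `(x, t)` is the tiling of the line by concatenated tiles with labels
`…, x (-1), x 0, x 1, …`, a tile with label `a` having length `ℓ a`, in which the tile
labelled `x 0` occupies the interval `[-t, -t + ℓ (x 0)]`. -/
def TilingSpace (X : SequenceSpace.{u}) (ℓ : X.Alphabet → ℝ) : Type u :=
  Quot (X.Glue ℓ)

instance (X : SequenceSpace.{u}) (ℓ : X.Alphabet → ℝ) : TopologicalSpace (X.TilingSpace ℓ) :=
  inferInstanceAs (TopologicalSpace (Quot (X.Glue ℓ)))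

/-- The translation action of `ℝ` on the tiling space: `s` sends `(x, t)` to `(x, t + s)`. -/
def translate (X : SequenceSpace.{u}) (ℓ : X.Alphabet → ℝ) (s : ℝ) :
    X.TilingSpace ℓ → X.TilingSpace ℓ :=
  Quot.map (fun p => (p.1, p.2 + s)) (by
    rintro ⟨x, t⟩ q rfl
    simp only [Glue, Prod.mk.injEq, true_and]
    ring)

/-- The tiling spaces with lengths `ℓ` and `ℓ'` are topologically conjugate: there is a
homeomorphism between them that commutes with translations. -/
def Conjugate (X : SequenceSpace.{u}) (ℓ ℓ' : X.Alphabet → ℝ) : Prop :=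
  ∃ h : X.TilingSpace ℓ ≃ₜ X.TilingSpace ℓ',
    ∀ (s : ℝ) (T : X.TilingSpace ℓ), h (X.translate ℓ s T) = X.translate ℓ' s (h T)

/-- Plasticity: every change of the (positive) tile lengths yields a topologically conjugate tiling
space, up to an overall rescaling (multiplying all lengths by the same `c > 0`). -/
def IsPlastic (X : SequenceSpace.{u}) : Prop :=
  ∀ ℓ ℓ' : X.Alphabet → ℝ, (∀ a, 0 < ℓ a) → (∀ a, 0 < ℓ' a) →
    ∃ c : ℝ, 0 < c ∧ X.Conjugate ℓ (c • ℓ')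

/-! ### Finite recodings -/

/-- The sliding block code of radius `r` given by the local rule `f`: the `n`-th letter of the
image is `f` of the letters at places `n - r, …, n + r`. -/
def blockCode {A B : Type u} (r : ℕ) (f : (Fin (2 * r + 1) → A) → B) (x : ℤ → A) : ℤ → B :=
  fun n => f fun i => x (n - r + (i : ℕ))

/-- `Y` is obtained from `X` by relabelling the letters according to their neighbourhoods
(a local rule) without loss of information. Collaring is the special case where the new label is
the whole neighbourhood. -/
def IsRelabelling (X Y : SequenceSpace.{u}) : Prop :=
  ∃ (r : ℕ) (f : (Fin (2 * r + 1) → X.Alphabet) → Y.Alphabet),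
    Set.BijOn (blockCode r f) X.seqs Y.seqs

/-- `Y` is obtained from `X` by dividing every tile with label `a` into `p a ≥ 1` consecutive
pieces, the `j`-th piece receiving the label `e ⟨a, j⟩`; different pieces get different labels.
The piece `j` of the `k`-th tile of `x` sits at place `s k + j` of the new sequence. Conversely,
`X` is then obtained from `Y` by amalgamating tiles. -/
def IsDivision (X Y : SequenceSpace.{u}) : Prop :=
  ∃ (p : X.Alphabet → ℕ) (e : (Σ a : X.Alphabet, Fin (p a)) → Y.Alphabet),
    (∀ a, 0 < p a) ∧ Function.Injective e ∧
    Y.seqs = {y | ∃ x ∈ X.seqs, ∃ s : ℤ → ℤ, (∀ k, s (k + 1) = s k + p (x k)) ∧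
      ∀ (k : ℤ) (j : Fin (p (x k))), y (s k + (j : ℕ)) = e ⟨x k, j⟩}

/-- `Y` is a finite recoding of `X`: it is obtained by finitely many steps, each of which is a
relabelling by a local rule (such as collaring), a division of tiles into pieces, or the inverse
of such a step (for instance an amalgamation of tiles). -/
def IsFiniteRecoding : SequenceSpace.{u} → SequenceSpace.{u} → Prop :=
  Relation.EqvGen fun X Y => X.IsRelabelling Y ∨ X.IsDivision Y

/-- Total plasticity: every finite recoding is plastic. -/
def IsTotallyPlastic (X : SequenceSpace.{u}) : Prop :=
  ∀ Y : SequenceSpace.{u}, X.IsFiniteRecoding Y → Y.IsPlastic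

end SequenceSpace

/-! Plasticity forces balance. Given a function φ of one letter, perturb the unit lengths to 1 + sφ
for uncountably many small s. Plasticity supplies conjugacies h_s from the unit-length tiling space
to the spaces with lengths c_s(1 + sφ). Whatever the lengths, a tiling space is covered by open arcs
indexed by one and the same finite set: an arc records the two letters around a nearby vertex and
the rough position of the origin, measured in fractions of a tile. Pull these covers back along h_s
to a compact second-countable space. A pigeonhole argument over finite families of basic open sets
gives s ≠ s' such that h_s T and h_s' T always lie in arcs with a common index
(`exists_ne_forall_exists_mem_inter`). Along an orbit the fractional indices of the two tilings then
differ by less than 1/2 from one fixed integer, so the label sequences agree up to a shift and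
corresponding vertices stay at bounded distance (`abs_vertex_sub_le_of_close`). Hence c_s(1 + sφ) −
c_s'(1 + s'φ) has bounded sums, and solving for φ gives bounded discrepancy
(`IsPlastic.exists_frequency`). For a word w, recode so that the occurrences of w become visible in
single letters.

Conversely, let the space be minimal and balanced. Rescale one length function so that both have the
same mean. Their difference has bounded sums, hence by Gottschalk–Hedlund is the coboundary of a
continuous b (`IsMinimal.exists_coboundary`), and moving the origin by b is a conjugacy
(`conjugate_of_coboundary`). For total plasticity, every recoding step exhibits one system as a
tower over the other (`IsTower`). Minimality, and bounded discrepancy of all locally constant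
functions, pass through towers in both directions, so every recoding is again minimal and balanced.
-/

/-! ### Two-sided partial sums -/

/-- The two-sided partial sums of `f : ℤ → M`, normalised to vanish at `0`. -/
noncomputable def signedSum {M : Type*} [AddCommGroup M] (f : ℤ → M) (n : ℤ) : M :=
  ∑ i ∈ Finset.Ico 0 n, f i - ∑ i ∈ Finset.Ico n 0, f i

section SignedSum

variable {M : Type*} [AddCommGroup M]

@[simp] theorem signedSum_zero (f : ℤ → M) : signedSum f 0 = 0 := by simp [signedSum]

theorem signedSum_add_one (f : ℤ → M) (n : ℤ) : signedSum f (n + 1) = signedSum f n + f n := by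
  unfold signedSum
  rcases le_or_gt 0 n with h | h
  · rw [← Finset.insert_Ico_right_eq_Ico_add_one h, Finset.sum_insert (by simp),
      Finset.Ico_eq_empty_of_le h, Finset.Ico_eq_empty_of_le (by omega : (0 : ℤ) ≤ n + 1)]
    simp [add_comm]
  · rw [← Finset.insert_Ico_add_one_left_eq_Ico h, Finset.sum_insert (by simp),
      Finset.Ico_eq_empty_of_le h.le, Finset.Ico_eq_empty_of_le (by omega : n + 1 ≤ 0)]
    simp

theorem signedSum_unique {f s : ℤ → M} (h0 : s 0 = 0) (h : ∀ n, s (n + 1) = s n + f n) (n : ℤ) :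
    s n = signedSum f n := by
  induction n using Int.induction_on with
  | zero => simp [h0]
  | succ i ih => rw [h, signedSum_add_one, ih]
  | pred i ih =>
    have h1 := h (-(i : ℤ) - 1)
    have h2 := signedSum_add_one f (-(i : ℤ) - 1)
    rw [sub_add_cancel] at h1 h2
    rw [h1, h2] at ih
    exact add_right_cancel ih

theorem signedSum_add (f : ℤ → M) (m n : ℤ) :
    signedSum f (m + n) = signedSum f m + signedSum (fun i => f (m + i)) n := by
  rw [← signedSum_unique (f := fun i => f (m + i))
    (s := fun n => signedSum f (m + n) - signedSum f m) (by simp)]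
  · simp
  · intro n
    rw [← add_assoc, signedSum_add_one]
    abel

theorem signedSum_natCast (f : ℤ → M) (n : ℕ) :
    signedSum f n = ∑ i ∈ Finset.range n, f i := by
  induction n with
  | zero => simp
  | succ n ih => rw [Nat.cast_succ, signedSum_add_one, ih, Finset.sum_range_succ]

theorem map_signedSum {N : Type*} [AddCommGroup N] (g : M →+ N) (f : ℤ → M) (n : ℤ) :
    g (signedSum f n) = signedSum (fun i => g (f i)) n := by
  simp [signedSum]

end SignedSum

theorem signedSum_const (c : ℝ) (n : ℤ) : signedSum (fun _ => c) n = n * c :=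
  (signedSum_unique (s := fun n : ℤ => (n : ℝ) * c) (by simp)
    (fun n => by push_cast; ring) n).symm

theorem signedSum_strictMono {f : ℤ → ℝ} (hf : ∀ i, 0 < f i) : StrictMono (signedSum f) :=
  strictMono_int_of_lt_succ fun n => by rw [signedSum_add_one]; linarith [hf n]

/-- The consecutive intervals of lengths `f i` cover the line. -/
theorem exists_signedSum_le_lt {f : ℤ → ℝ} {ε : ℝ} (hε : 0 < ε) (hf : ∀ i, ε ≤ f i) (t : ℝ) :
    ∃ n, signedSum f n ≤ t ∧ t < signedSum f (n + 1) := by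
  have hmono : StrictMono (signedSum f) := signedSum_strictMono fun i => hε.trans_le (hf i)
  -- The sums grow at least linearly with slope ε, so the indices with sum at most t are bounded
  -- above and not empty; the greatest one is the answer.
  have hlin : Monotone fun n : ℤ => signedSum f n - n * ε :=
    monotone_int_of_le_succ fun n => by
      rw [signedSum_add_one]; push_cast; linarith [hf n]
  obtain ⟨N, hN⟩ := exists_int_gt (t / ε)
  obtain ⟨N', hN'⟩ := exists_int_lt (t / ε)
  rw [div_lt_iff₀ hε] at hN
  rw [lt_div_iff₀ hε] at hN'
  obtain ⟨n, hn, hmax⟩ := Int.exists_greatest_of_bdd (P := fun n => signedSum f n ≤ t)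
    ⟨max N 0, fun z hz => by
      by_contra! hlt
      have h1 := hlin ((le_max_right N 0).trans hlt.le)
      have h2 : (N : ℝ) ≤ z := by exact_mod_cast (le_max_left N 0).trans hlt.le
      simp only [signedSum_zero, Int.cast_zero, zero_mul, sub_zero] at h1
      nlinarith⟩
    ⟨min N' 0, by
      have h1 := hlin (min_le_right N' 0)
      have h2 : ((min N' 0 : ℤ) : ℝ) ≤ N' := by exact_mod_cast min_le_left N' 0
      simp only [signedSum_zero, Int.cast_zero, zero_mul, sub_zero] at h1
      nlinarith⟩
  refine ⟨n, hn, ?_⟩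
  by_contra! h
  have := hmax _ h
  omega

/-! ### Piecewise linear interpolation -/

/-- The piecewise linear interpolation of the two-sided partial sums. -/
noncomputable def interpolate (f : ℤ → ℝ) (x : ℝ) : ℝ :=
  signedSum f ⌊x⌋ + Int.fract x * f ⌊x⌋

theorem interpolate_add {f : ℤ → ℝ} {n : ℤ} {r : ℝ} (h0 : 0 ≤ r) (h1 : r ≤ 1) :
    interpolate f (n + r) = signedSum f n + r * f n := by
  rcases h1.lt_or_eq with h | rfl
  · have hfl : ⌊(n : ℝ) + r⌋ = n := by
      rw [Int.floor_eq_iff]; constructor <;> linarith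
    rw [interpolate, Int.fract, hfl]; ring
  · have hfl : ⌊(n : ℝ) + 1⌋ = n + 1 := by simp
    rw [interpolate, Int.fract, hfl, signedSum_add_one]; push_cast; ring

theorem interpolate_strictMono {f : ℤ → ℝ} (hf : ∀ i, 0 < f i) : StrictMono (interpolate f) := by
  intro x y hxy
  rcases (Int.floor_mono hxy.le).eq_or_lt with h | h
  · simp only [interpolate, h]
    have : Int.fract x < Int.fract y := by
      simp only [Int.fract, h]; linarith
    nlinarith [hf ⌊y⌋]
  · have h1 : signedSum f (⌊x⌋ + 1) ≤ signedSum f ⌊y⌋ := (signedSum_strictMono hf).monotone h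
    rw [signedSum_add_one] at h1
    have h2 := Int.fract_lt_one x
    have h3 := Int.fract_nonneg y
    simp only [interpolate]
    nlinarith [hf ⌊y⌋, hf ⌊x⌋]

theorem interpolate_surjective {f : ℤ → ℝ} {ε : ℝ} (hε : 0 < ε) (hf : ∀ i, ε ≤ f i) :
    Function.Surjective (interpolate f) := by
  intro t
  obtain ⟨n, h1, h2⟩ := exists_signedSum_le_lt hε hf t
  rw [signedSum_add_one] at h2
  have hn : 0 < f n := hε.trans_le (hf n)
  refine ⟨n + (t - signedSum f n) / f n, ?_⟩
  rw [interpolate_add (div_nonneg (by linarith) hn.le) ((div_le_one hn).2 (by linarith)),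
    div_mul_cancel₀ _ hn.ne']
  ring

/-- The fractional index of the point `t` with respect to the consecutive intervals of
lengths `f i`. -/
noncomputable def fracIndex (f : ℤ → ℝ) : ℝ → ℝ := Function.invFun (interpolate f)

theorem fracIndex_interpolate {f : ℤ → ℝ} (hf : ∀ i, 0 < f i) (x : ℝ) :
    fracIndex f (interpolate f x) = x :=
  Function.leftInverse_invFun (interpolate_strictMono hf).injective x

/-- The interpolation is an order isomorphism of the line, and the inverse of an order isomorphism
is continuous. -/
theorem continuous_fracIndex {f : ℤ → ℝ} {ε : ℝ} (hε : 0 < ε) (hf : ∀ i, ε ≤ f i) :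
    Continuous (fracIndex f) := by
  have hmono := interpolate_strictMono fun i => hε.trans_le (hf i)
  have h : fracIndex f =
      (hmono.orderIsoOfSurjective _ (interpolate_surjective hε hf)).symm := by
    ext t
    obtain ⟨x, rfl⟩ := interpolate_surjective hε hf t
    rw [fracIndex_interpolate fun i => hε.trans_le (hf i)]
    exact ((hmono.orderIsoOfSurjective _ (interpolate_surjective hε hf)).symm_apply_apply x).symm
  rw [h]
  exact OrderIso.continuous _

/-- Within distance one of a vertex, the fractional index is computed from the lengths of the
two intervals meeting there. -/
theorem fracIndex_eq {f : ℤ → ℝ} (hf : ∀ i, 0 < f i) (n : ℤ) {r : ℝ} (h0 : -1 ≤ r) (h1 : r ≤ 1) :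
    fracIndex f (signedSum f n + r * (if 0 ≤ r then f n else f (n - 1))) = n + r := by
  rw [← fracIndex_interpolate hf (n + r)]
  congr 1
  split_ifs with h
  · rw [interpolate_add h h1]
  · have h2 := interpolate_add (f := f) (n := n - 1) (r := 1 + r) (by linarith) (by linarith)
    have h3 := signedSum_add_one f (n - 1)
    rw [sub_add_cancel] at h3
    rw [show (n : ℝ) + r = ((n - 1 : ℤ) : ℝ) + (1 + r) by push_cast; ring, h2, h3]
    ring

theorem fracIndex_signedSum {f : ℤ → ℝ} (hf : ∀ i, 0 < f i) (n : ℤ) :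
    fracIndex f (signedSum f n) = n := by
  simpa using fracIndex_eq hf n (r := 0) (by norm_num) (by norm_num)

namespace SequenceSpace

/-! ### The shift homeomorphisms -/

instance (X : SequenceSpace.{u}) : CompactSpace X.seqs :=
  isCompact_iff_compactSpace.1 X.toSubshift.isClosed.isCompact

instance (X : SequenceSpace.{u}) : Nonempty X.seqs := X.nonempty.to_subtype

/-- The `n`-th power of the shift. -/
def shiftBy (X : SequenceSpace.{u}) (n : ℤ) (x : X.seqs) : X.seqs :=
  ⟨shift n x.1, X.toSubshift.mapsTo n x.2⟩

section ShiftBy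

variable {X : SequenceSpace.{u}}

@[simp] theorem shiftBy_apply (n k : ℤ) (x : X.seqs) : (X.shiftBy n x).1 k = x.1 (n + k) := rfl

@[simp] theorem shiftBy_zero (x : X.seqs) : X.shiftBy 0 x = x :=
  Subtype.ext <| funext fun k => by simp

theorem shiftBy_shiftBy (m n : ℤ) (x : X.seqs) :
    X.shiftBy m (X.shiftBy n x) = X.shiftBy (n + m) x :=
  Subtype.ext <| funext fun k => by simp [add_assoc]

@[simp] theorem sigma_apply (x : X.seqs) (k : ℤ) : (X.sigma x).1 k = x.1 (1 + k) := rfl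

theorem sigma_eq_shiftBy (x : X.seqs) : X.sigma x = X.shiftBy 1 x := rfl

theorem sigma_iterate (n : ℕ) (x : X.seqs) : X.sigma^[n] x = X.shiftBy n x := by
  induction n with
  | zero => simp
  | succ n ih =>
    rw [Function.iterate_succ_apply', ih, sigma_eq_shiftBy, shiftBy_shiftBy, Nat.cast_succ]

theorem continuous_shiftBy (n : ℤ) : Continuous (X.shiftBy n) :=
  ((continuous_shift n).comp continuous_subtype_val).subtype_mk _

theorem continuous_sigma : Continuous X.sigma := continuous_shiftBy 1

theorem continuous_coord (k : ℤ) : Continuous fun x : X.seqs => x.1 k :=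
  (continuous_apply k).comp continuous_subtype_val

theorem isClopen_coord (k : ℤ) (s : Set X.Alphabet) : IsClopen {x : X.seqs | x.1 k ∈ s} :=
  (isClopen_discrete s).preimage (continuous_coord k)

end ShiftBy

/-- The position of the left end of the `n`-th tile, when the left end of the `0`-th tile is put
at the origin. -/
noncomputable def vertex (X : SequenceSpace.{u}) (ℓ : X.Alphabet → ℝ) (x : X.seqs) (n : ℤ) : ℝ :=
  signedSum (fun i => ℓ (x.1 i)) n

section Vertex

variable {X : SequenceSpace.{u}} {ℓ : X.Alphabet → ℝ}

theorem vertex_shiftBy (x : X.seqs) (m n : ℤ) :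
    X.vertex ℓ (X.shiftBy m x) n = X.vertex ℓ x (m + n) - X.vertex ℓ x m := by
  simp only [vertex, shiftBy_apply, signedSum_add _ m n]; ring

@[simp] theorem vertex_zero (x : X.seqs) : X.vertex ℓ x 0 = 0 := signedSum_zero _

theorem vertex_one (x : X.seqs) : X.vertex ℓ x 1 = ℓ (x.1 0) := by
  simpa [vertex] using signedSum_add_one (fun i => ℓ (x.1 i)) 0

theorem vertex_natCast (x : X.seqs) (n : ℕ) :
    X.vertex ℓ x n = birkhoffSum X.sigma (fun y => ℓ (y.1 0)) n x := by
  simp only [vertex, signedSum_natCast, birkhoffSum, sigma_iterate, shiftBy_apply, add_zero]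

theorem continuous_vertex (n : ℤ) : Continuous fun x : X.seqs => X.vertex ℓ x n := by
  have (i : ℤ) : Continuous fun x : X.seqs => ℓ (x.1 i) :=
    continuous_of_discreteTopology.comp (continuous_coord i)
  exact (continuous_finsetSum _ fun i _ => this i).sub (continuous_finsetSum _ fun i _ => this i)

/-- A uniform positive lower bound for finitely many positive lengths. -/
theorem exists_pos_le_length (hℓ : ∀ a, 0 < ℓ a) : ∃ ε > 0, ∀ a, ε ≤ ℓ a := by
  have : Nonempty X.Alphabet := ⟨(Classical.arbitrary X.seqs).1 0⟩
  obtain ⟨a, ha⟩ := Finite.exists_min ℓ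
  exact ⟨ℓ a, hℓ a, ha⟩

theorem exists_length_le (ℓ : X.Alphabet → ℝ) : ∃ M, ∀ a, |ℓ a| ≤ M := by
  have : Nonempty X.Alphabet := ⟨(Classical.arbitrary X.seqs).1 0⟩
  obtain ⟨a, ha⟩ := Finite.exists_max fun a => |ℓ a|
  exact ⟨_, ha⟩

end Vertex

/-! ### Tiling spaces as orbit spaces -/

section TilingSpace

variable {X : SequenceSpace.{u}} {ℓ : X.Alphabet → ℝ}

/-- The tiling with label sequence `x` in which the origin lies at distance `t` to the right of
the left end of the `0`-th tile. -/
def mkTiling (X : SequenceSpace.{u}) (ℓ : X.Alphabet → ℝ) (p : X.seqs × ℝ) : X.TilingSpace ℓ :=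
  Quot.mk _ p

theorem continuous_mkTiling : Continuous (X.mkTiling ℓ) := continuous_quot_mk

theorem mkTiling_surjective : Function.Surjective (X.mkTiling ℓ) := Quot.mk_surjective

theorem translate_mkTiling (s : ℝ) (x : X.seqs) (t : ℝ) :
    X.translate ℓ s (X.mkTiling ℓ (x, t)) = X.mkTiling ℓ (x, t + s) := rfl

/-- The other representatives of a tiling. -/
noncomputable def slide (X : SequenceSpace.{u}) (ℓ : X.Alphabet → ℝ) (n : ℤ) (p : X.seqs × ℝ) :
    X.seqs × ℝ :=
  (X.shiftBy n p.1, p.2 - X.vertex ℓ p.1 n)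

theorem slide_slide (m n : ℤ) (p : X.seqs × ℝ) :
    X.slide ℓ m (X.slide ℓ n p) = X.slide ℓ (n + m) p := by
  simp only [slide, shiftBy_shiftBy, vertex_shiftBy, Prod.mk.injEq, true_and]; ring

@[simp] theorem slide_zero (p : X.seqs × ℝ) : X.slide ℓ 0 p = p := by simp [slide]

theorem glue_iff (p q : X.seqs × ℝ) : X.Glue ℓ p q ↔ q = X.slide ℓ 1 p := by
  simp only [Glue, slide, vertex_one, sigma_eq_shiftBy]

theorem mkTiling_slide (n : ℤ) (p : X.seqs × ℝ) :
    X.mkTiling ℓ (X.slide ℓ n p) = X.mkTiling ℓ p := by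
  have h1 (q : X.seqs × ℝ) : X.mkTiling ℓ (X.slide ℓ 1 q) = X.mkTiling ℓ q :=
    (Quot.sound ((glue_iff _ _).2 rfl)).symm
  induction n using Int.induction_on with
  | zero => simp
  | succ i ih => rw [← slide_slide, h1, ih]
  | pred i ih => rw [← h1, slide_slide, sub_add_cancel, ih]

theorem mkTiling_eq_iff {p q : X.seqs × ℝ} :
    X.mkTiling ℓ p = X.mkTiling ℓ q ↔ ∃ n, q = X.slide ℓ n p := by
  constructor
  · intro h
    induction Quot.eqvGen_exact h with
    | rel p q h => exact ⟨1, (glue_iff _ _).1 ‹_›⟩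
    | refl p => exact ⟨0, (slide_zero p).symm⟩
    | symm p q _ ih =>
      obtain ⟨n, rfl⟩ := ih (Quot.eqvGen_sound ‹_›)
      exact ⟨-n, by rw [slide_slide, add_neg_cancel, slide_zero]⟩
    | trans p q r _ _ ih1 ih2 =>
      obtain ⟨n, rfl⟩ := ih1 (Quot.eqvGen_sound ‹_›)
      obtain ⟨m, rfl⟩ := ih2 (Quot.eqvGen_sound ‹_›)
      exact ⟨n + m, slide_slide _ _ _⟩
  · rintro ⟨n, rfl⟩
    exact (mkTiling_slide n p).symm

theorem continuous_slide (n : ℤ) : Continuous (X.slide ℓ n) :=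
  ((continuous_shiftBy n).comp continuous_fst).prodMk
    (continuous_snd.sub ((continuous_vertex n).comp continuous_fst))

/-- The saturation of an open set is the union of its preimages under the countably many continuous
maps `slide`. This makes the arcs open. -/
theorem isOpenMap_mkTiling : IsOpenMap (X.mkTiling ℓ) := by
  intro W hW
  have h : X.mkTiling ℓ ⁻¹' (X.mkTiling ℓ '' W) = ⋃ n : ℤ, X.slide ℓ n ⁻¹' W := by
    ext p
    simp only [Set.mem_preimage, Set.mem_image, Set.mem_iUnion]
    constructor
    · rintro ⟨q, hq, h⟩
      obtain ⟨n, rfl⟩ := mkTiling_eq_iff.1 h.symm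
      exact ⟨n, hq⟩
    · rintro ⟨n, hn⟩
      exact ⟨_, hn, mkTiling_slide n p⟩
  refine isOpen_coinduced.2 ?_
  change IsOpen (X.mkTiling ℓ ⁻¹' (X.mkTiling ℓ '' W))
  rw [h]
  exact isOpen_iUnion fun n => hW.preimage (continuous_slide n)

/-! ### A cover by small arcs -/

/-- The position at fractional index `r` next to a vertex between tiles of lengths `a` and `b`. -/
noncomputable def localPos (a b r : ℝ) : ℝ := r * if 0 ≤ r then b else a

/-- The tilings with the two letters `a b` next to a vertex that the origin lies close to, at
fractional index between `(j - 1) / 4` and `(j + 1) / 4` relative to it. -/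
def arc (X : SequenceSpace.{u}) (ℓ : X.Alphabet → ℝ) (i : Fin 4 × X.Alphabet × X.Alphabet) :
    Set (X.TilingSpace ℓ) :=
  X.mkTiling ℓ '' {p | p.1.1 (-1) = i.2.1 ∧ p.1.1 0 = i.2.2 ∧
    p.2 ∈ Set.Ioo (localPos (ℓ i.2.1) (ℓ i.2.2) (((i.1 : ℕ) - 1) / 4))
      (localPos (ℓ i.2.1) (ℓ i.2.2) (((i.1 : ℕ) + 1) / 4))}

theorem isOpen_arc (i : Fin 4 × X.Alphabet × X.Alphabet) : IsOpen (X.arc ℓ i) := by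
  refine isOpenMap_mkTiling _ ?_
  have h1 := ((isClopen_coord (X := X) (-1) {i.2.1}).isOpen).preimage
    (continuous_fst (X := X.seqs) (Y := ℝ))
  have h2 := ((isClopen_coord (X := X) 0 {i.2.2}).isOpen).preimage
    (continuous_fst (X := X.seqs) (Y := ℝ))
  exact h1.inter (h2.inter (isOpen_Ioo.preimage continuous_snd))

/-- Cut the tile containing the origin into quarters. The quarter [j/4, (j+1)/4) lies in the open
window ((j−1)/4, (j+1)/4), for j = 0, …, 3. The index set does not depend on the lengths, which is
what allows different length functions to be compared. -/
theorem exists_mem_arc (hℓ : ∀ a, 0 < ℓ a) (T : X.TilingSpace ℓ) : ∃ i, T ∈ X.arc ℓ i := by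
  obtain ⟨⟨x, t⟩, rfl⟩ := mkTiling_surjective T
  obtain ⟨ε, hε, hle⟩ := exists_pos_le_length hℓ
  obtain ⟨n, h1, h2⟩ := exists_signedSum_le_lt hε (fun i => hle (x.1 i)) t
  rw [signedSum_add_one] at h2
  have key : ∃ j : Fin 4, ∀ y : X.seqs, ∀ s : ℝ, 0 ≤ s → s < ℓ (y.1 0) →
      y.1 0 = x.1 n → s = t - X.vertex ℓ x n →
      X.mkTiling ℓ (y, s) ∈ X.arc ℓ (j, y.1 (-1), y.1 0) := by
    have hb := hℓ (x.1 n)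
    have ha := fun a => hℓ a
    rcases lt_or_ge (t - X.vertex ℓ x n) (ℓ (x.1 n) / 4) with h3 | h3
    · refine ⟨0, fun y s hs0 hs1 hy hs => ⟨(y, s), ⟨rfl, rfl, ?_⟩, rfl⟩⟩
      have := ha (y.1 (-1))
      norm_num [localPos]
      rw [hy] at hs1 ⊢
      constructor <;> linarith
    rcases lt_or_ge (t - X.vertex ℓ x n) (ℓ (x.1 n) / 2) with h4 | h4
    · refine ⟨1, fun y s hs0 hs1 hy hs => ⟨(y, s), ⟨rfl, rfl, ?_⟩, rfl⟩⟩
      norm_num [localPos]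
      rw [hy] at hs1 ⊢
      constructor <;> linarith
    rcases lt_or_ge (t - X.vertex ℓ x n) (3 * ℓ (x.1 n) / 4) with h5 | h5
    · refine ⟨2, fun y s hs0 hs1 hy hs => ⟨(y, s), ⟨rfl, rfl, ?_⟩, rfl⟩⟩
      norm_num [localPos]
      rw [hy] at hs1 ⊢
      constructor <;> linarith
    · refine ⟨3, fun y s hs0 hs1 hy hs => ⟨(y, s), ⟨rfl, rfl, ?_⟩, rfl⟩⟩
      norm_num [localPos]
      rw [hy] at hs1 ⊢
      constructor <;> linarith
  obtain ⟨j, hj⟩ := key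
  have := hj (X.shiftBy n x) (t - X.vertex ℓ x n) (by simpa [vertex] using h1)
    (by simp [vertex]; linarith) (by simp) rfl
  rw [← mkTiling_slide n]
  exact ⟨_, this⟩

/-- The fractional index of a tiling in an arc. -/
theorem exists_fracIndex_of_mem_arc (hℓ : ∀ a, 0 < ℓ a) {i : Fin 4 × X.Alphabet × X.Alphabet}
    {x : X.seqs} {t : ℝ} (h : X.mkTiling ℓ (x, t) ∈ X.arc ℓ i) :
    ∃ (n : ℤ) (r : ℝ), x.1 n = i.2.2 ∧
      r ∈ Set.Ioo (((i.1 : ℕ) - 1 : ℝ) / 4) (((i.1 : ℕ) + 1) / 4) ∧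
      fracIndex (fun k => ℓ (x.1 k)) t = n + r := by
  obtain ⟨q, ⟨ha, hb, hq⟩, h⟩ := h
  obtain ⟨n, rfl⟩ := mkTiling_eq_iff.1 h.symm
  obtain ⟨⟨j, hj⟩, a, b⟩ := i
  simp only [slide, shiftBy_apply, add_zero] at ha hb hq
  have ha' := hℓ a
  have hb' := hℓ b
  have hj' : (j : ℝ) ≤ 3 := by exact_mod_cast Nat.le_of_lt_succ hj
  have hj0 : (0 : ℝ) ≤ j := j.cast_nonneg
  have hmono : StrictMono (localPos (ℓ a) (ℓ b)) := by
    intro r s hrs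
    unfold localPos
    split_ifs <;> nlinarith
  obtain ⟨r, hr⟩ : ∃ r, localPos (ℓ a) (ℓ b) r = t - X.vertex ℓ x n := by
    rcases le_or_gt 0 (t - X.vertex ℓ x n) with h0 | h0
    · refine ⟨(t - X.vertex ℓ x n) / ℓ b, ?_⟩
      rw [localPos, if_pos (div_nonneg h0 hb'.le), div_mul_cancel₀ _ hb'.ne']
    · refine ⟨(t - X.vertex ℓ x n) / ℓ a, ?_⟩
      rw [localPos, if_neg (not_le.2 (div_neg_of_neg_of_pos h0 ha')), div_mul_cancel₀ _ ha'.ne']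
  rw [← hr] at hq
  have hq1 := hmono.lt_iff_lt.1 hq.1
  have hq2 := hmono.lt_iff_lt.1 hq.2
  refine ⟨n, r, hb, ⟨hq1, hq2⟩, ?_⟩
  -- As 0 ≤ j ≤ 3, the window lies in [−1/4, 1], within the range where only the two tiles at the
  -- vertex matter.
  rw [← fracIndex_eq (fun k => hℓ (x.1 k)) n (r := r) (by linarith) (by linarith)]
  have hn : n - 1 = n + -1 := by ring
  rw [hn, ha, hb]
  rw [localPos] at hr
  rw [hr, vertex]
  congr 1
  ring

end TilingSpace

end SequenceSpace

/-! ### Pigeonhole for open covers, and synchronised fractional indices -/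

/-- Among uncountably many open covers of a compact second-countable space by sets indexed by a
common set, two have the property that every point lies in two sets with the same index. -/
theorem exists_ne_forall_exists_mem_inter {K I J : Type*} [TopologicalSpace K] [CompactSpace K]
    [SecondCountableTopology K] [Countable I] [Uncountable J] (O : J → I → Set K)
    (hO : ∀ j i, IsOpen (O j i)) (hcover : ∀ j x, ∃ i, x ∈ O j i) :
    ∃ j j', j ≠ j' ∧ ∀ x, ∃ i, x ∈ O j i ∧ x ∈ O j' i := by
  let B := TopologicalSpace.countableBasis K
  have hB := TopologicalSpace.isBasis_countableBasis K
  have : Countable B := (TopologicalSpace.countable_countableBasis K).to_subtype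
  -- By compactness each cover is refined by a finite family of basic open sets, each tagged with
  -- the index of a set containing it.
  have key (j : J) : ∃ F : Finset (I × B), (∀ q ∈ F, (q.2 : Set K) ⊆ O j q.1) ∧
      ∀ x, ∃ q ∈ F, x ∈ (q.2 : Set K) := by
    let Q := {q : I × B // (q.2 : Set K) ⊆ O j q.1}
    obtain ⟨F, hF⟩ := isCompact_univ.elim_finite_subcover (fun q : Q => (q.1.2 : Set K))
      (fun q => hB.isOpen q.1.2.2) (fun x _ => by
        obtain ⟨i, hi⟩ := hcover j x
        obtain ⟨b, hb, hxb, hbO⟩ := hB.exists_subset_of_mem_open hi (hO j i)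
        exact Set.mem_iUnion.2 ⟨⟨(i, ⟨b, hb⟩), hbO⟩, hxb⟩)
    refine ⟨F.map (Function.Embedding.subtype _), fun q hq => ?_, fun x => ?_⟩
    · obtain ⟨q, _, rfl⟩ := Finset.mem_map.1 hq
      exact q.2
    · obtain ⟨q, hq, hx⟩ := Set.mem_iUnion₂.1 (hF (Set.mem_univ x))
      exact ⟨q.1, Finset.mem_map_of_mem _ hq, hx⟩
  choose F hF1 hF2 using key
  -- There are only countably many such tagged families, so two covers share one.
  have hF := not_injective_uncountable_countable F
  simp only [Function.Injective, not_forall] at hF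
  obtain ⟨j, j', hjj, hne⟩ := hF
  refine ⟨j, j', hne, fun x => ?_⟩
  obtain ⟨q, hq, hx⟩ := hF2 j x
  exact ⟨q.1, hF1 j q hq hx, hF1 j' q (hjj ▸ hq) hx⟩

/-- A continuous function whose values keep a distance less than `1 / 2` from the integers stays
close to one integer. -/
theorem exists_int_forall_abs_sub_lt {d : ℝ → ℝ} (hd : Continuous d)
    (h : ∀ s, ∃ k : ℤ, |d s - k| < 1 / 2) : ∃ k : ℤ, ∀ s, |d s - k| < 1 / 2 := by
  obtain ⟨k, hk⟩ := h 0
  have hcont : Continuous fun s => |d s - k| := (hd.sub continuous_const).abs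
  have hclopen : IsClopen {s | |d s - k| < 1 / 2} := by
    refine ⟨?_, isOpen_lt hcont continuous_const⟩
    convert isClosed_le hcont (continuous_const (y := (1 / 2 : ℝ))) using 1
    ext s
    refine ⟨fun hs => le_of_lt (Set.mem_ofPred.1 hs), fun hs => ?_⟩
    obtain ⟨k', hk'⟩ := h s
    have hs' : |d s - k| ≤ 1 / 2 := hs
    rw [abs_le] at hs'
    have hk2 := abs_lt.1 hk'
    have h1 : ((k - k' : ℤ) : ℝ) < 1 := by push_cast; linarith
    have h2 : ((-1 : ℤ) : ℝ) < (k - k' : ℤ) := by push_cast; linarith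
    have h3 : k - k' < 1 := by exact_mod_cast h1
    have h4 : -1 < k - k' := by exact_mod_cast h2
    obtain rfl : k = k' := by omega
    exact hk'
  exact ⟨k, fun s => (hclopen.eq_univ ⟨0, hk⟩).ge (Set.mem_univ s)⟩

theorem interpolate_fracIndex {f : ℤ → ℝ} {ε : ℝ} (hε : 0 < ε) (hf : ∀ i, ε ≤ f i) (t : ℝ) :
    interpolate f (fracIndex f t) = t :=
  Function.rightInverse_invFun (interpolate_surjective hε hf) t

/-- At fractional distance at most one from a vertex, the point lies in one of the two tiles meeting
there, and these have length at most `M`. -/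
theorem abs_sub_signedSum_le {f : ℤ → ℝ} {ε M : ℝ} (hε : 0 < ε) (hf : ∀ i, ε ≤ f i)
    (hM : ∀ i, f i ≤ M) {t : ℝ} {n : ℤ} (h : |fracIndex f t - n| ≤ 1) :
    |t - signedSum f n| ≤ M := by
  have hpos i : 0 < f i := hε.trans_le (hf i)
  set r := fracIndex f t - n with hr
  have h1 := fracIndex_eq hpos n (r := r) (abs_le.1 h).1 (abs_le.1 h).2
  rw [hr, add_sub_cancel, ← hr] at h1
  have h2 := congrArg (interpolate f) h1
  rw [interpolate_fracIndex hε hf, interpolate_fracIndex hε hf] at h2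
  rw [← h2, add_sub_cancel_left, abs_mul]
  have h3 : |if 0 ≤ r then f n else f (n - 1)| ≤ M := by
    split_ifs
    · rw [abs_of_pos (hpos _)]; exact hM _
    · rw [abs_of_pos (hpos _)]; exact hM _
  calc |r| * _ ≤ 1 * M := mul_le_mul h h3 (abs_nonneg _) zero_le_one
    _ = M := one_mul M

/-! ### From plasticity to bounded discrepancy -/

namespace SequenceSpace

variable {X : SequenceSpace.{u}}

/-- Two tilings that stay close while they are translated have the same sequence of labels. -/
theorem exists_shift_of_forall_mem_arc {ℓ m : X.Alphabet → ℝ} (hℓ : ∀ a, 0 < ℓ a)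
    (hm : ∀ a, 0 < m a) {x y : X.seqs} {t t' : ℝ}
    (h : ∀ s, ∃ i, X.mkTiling ℓ (x, t + s) ∈ X.arc ℓ i ∧ X.mkTiling m (y, t' + s) ∈ X.arc m i) :
    ∃ k : ℤ, (∀ s, |fracIndex (fun i => ℓ (x.1 i)) (t + s)
        - fracIndex (fun i => m (y.1 i)) (t' + s) - k| < 1 / 2) ∧
      ∀ i, x.1 i = y.1 (i - k) := by
  obtain ⟨ε, hε, hle⟩ := exists_pos_le_length hℓ
  obtain ⟨δ, hδ, hle'⟩ := exists_pos_le_length hm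
  have hd : Continuous fun s => fracIndex (fun i => ℓ (x.1 i)) (t + s)
      - fracIndex (fun i => m (y.1 i)) (t' + s) :=
    ((continuous_fracIndex hε fun i => hle (x.1 i)).comp (continuous_const.add continuous_id)).sub
      ((continuous_fracIndex hδ fun i => hle' (y.1 i)).comp (continuous_const.add continuous_id))
  -- Both offsets `r` and `r'` lie in the same open window of length 1/2, so the indices differ from
  -- `n - n'` by less than 1/2.
  obtain ⟨k, hk⟩ := exists_int_forall_abs_sub_lt hd fun s => by
    obtain ⟨i, h1, h2⟩ := h s
    obtain ⟨n, r, -, ⟨hr1, hr2⟩, hn⟩ := exists_fracIndex_of_mem_arc hℓ h1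
    obtain ⟨n', r', -, ⟨hr1', hr2'⟩, hn'⟩ := exists_fracIndex_of_mem_arc hm h2
    refine ⟨n - n', ?_⟩
    rw [hn, hn', abs_lt]
    push_cast
    constructor <;> linarith
  refine ⟨k, hk, fun i => ?_⟩
  -- Translate the origin to the middle of tile `i` of `x`. The window lies in (−1/4, 1), which
  -- forces `n = i`, and closeness to `k` then forces `n' = i - k`; the common arc index gives equal
  -- letters there.
  obtain ⟨j, h1, h2⟩ := h (interpolate (fun i => ℓ (x.1 i)) (i + 1 / 2) - t)
  obtain ⟨n, r, hxn, ⟨hr1, hr2⟩, hn⟩ := exists_fracIndex_of_mem_arc hℓ h1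
  obtain ⟨n', r', hyn, ⟨hr1', hr2'⟩, hn'⟩ := exists_fracIndex_of_mem_arc hm h2
  have hk' := hk (interpolate (fun i => ℓ (x.1 i)) (i + 1 / 2) - t)
  rw [hn, hn', abs_lt] at hk'
  rw [add_sub_cancel, fracIndex_interpolate fun i => hℓ (x.1 i)] at hn
  have hj3 : ((j.1 : ℕ) : ℝ) ≤ 3 := by exact_mod_cast Nat.le_of_lt_succ j.1.2
  have hj0 : (0 : ℝ) ≤ ((j.1 : ℕ) : ℝ) := Nat.cast_nonneg _
  have e1 : ((i - n : ℤ) : ℝ) < 1 := by push_cast; linarith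
  have e2 : ((-1 : ℤ) : ℝ) < (i - n : ℤ) := by push_cast; linarith
  have e3 : i - n < 1 := by exact_mod_cast e1
  have e4 : -1 < i - n := by exact_mod_cast e2
  have f1 : ((n - n' - k : ℤ) : ℝ) < 1 := by push_cast; linarith
  have f2 : ((-1 : ℤ) : ℝ) < (n - n' - k : ℤ) := by push_cast; linarith
  have f3 : n - n' - k < 1 := by exact_mod_cast f1
  have f4 : -1 < n - n' - k := by exact_mod_cast f2
  obtain rfl : i = n := by omega
  obtain rfl : n' = i - k := by omega
  rw [hxn, hyn]

/-- If two conjugacies from the same tiling space are close, then the two length functions assign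
nearly the same lengths to all words. -/
theorem abs_vertex_sub_le_of_close {ℓ₀ ℓ m : X.Alphabet → ℝ} (hℓ : ∀ a, 0 < ℓ a)
    (hm : ∀ a, 0 < m a) (h : X.TilingSpace ℓ₀ ≃ₜ X.TilingSpace ℓ)
    (h' : X.TilingSpace ℓ₀ ≃ₜ X.TilingSpace m)
    (hh : ∀ s T, h (X.translate ℓ₀ s T) = X.translate ℓ s (h T))
    (hh' : ∀ s T, h' (X.translate ℓ₀ s T) = X.translate m s (h' T))
    (hclose : ∀ T, ∃ i, h T ∈ X.arc ℓ i ∧ h' T ∈ X.arc m i) :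
    ∃ C, ∀ (x : X.seqs) (n : ℤ), |X.vertex ℓ x n - X.vertex m x n| ≤ C := by
  obtain ⟨δ, hδ, hle'⟩ := exists_pos_le_length hm
  obtain ⟨M, hM⟩ := exists_length_le m
  refine ⟨2 * M, fun x n => ?_⟩
  -- Start from the tiling whose image under `h` has the vertex `0` of `x` at the origin, and
  -- represent its image under `h'` by `(y, t')`.
  obtain ⟨⟨y, t'⟩, hy⟩ := mkTiling_surjective (h' (h.symm (X.mkTiling ℓ (x, 0))))
  obtain ⟨k, hk, hxy⟩ := exists_shift_of_forall_mem_arc (t := 0) (t' := t') (x := x) (y := y)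
    hℓ hm fun s => by
      obtain ⟨i, h1, h2⟩ := hclose (X.translate ℓ₀ s (h.symm (X.mkTiling ℓ (x, 0))))
      rw [hh, h.apply_symm_apply, translate_mkTiling] at h1
      rw [hh', ← hy, translate_mkTiling] at h2
      exact ⟨i, h1, h2⟩
  -- When the origin reaches vertex `j` of `x`, it is within fractional distance 1/2 of vertex `j -
  -- k` of `y`. Using this at both ends `0` and `n` gives the constant `2 * M`.
  have key (j : ℤ) : |t' + X.vertex ℓ x j - X.vertex m y (j - k)| ≤ M := by
    refine abs_sub_signedSum_le hδ (fun i => hle' (y.1 i))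
      (fun i => (le_abs_self _).trans (hM (y.1 i))) ?_
    have := hk (X.vertex ℓ x j)
    rw [zero_add, vertex, fracIndex_signedSum fun i => hℓ (x.1 i)] at this
    rw [vertex]
    push_cast
    rw [abs_lt] at this
    rw [abs_le]
    constructor <;> linarith
  have e : X.vertex m x n = X.vertex m y (n - k) - X.vertex m y (0 - k) := by
    have h1 : x = X.shiftBy (-k) y :=
      Subtype.ext <| funext fun i => (hxy i).trans (by rw [shiftBy_apply, sub_eq_neg_add])
    rw [h1, vertex_shiftBy]
    congr 2 <;> ring
  have k0 := abs_le.1 (key 0)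
  have kn := abs_le.1 (key n)
  rw [vertex_zero] at k0
  rw [e, abs_le]
  constructor <;> linarith

/-- Covers of the unit-length tiling space can thus be pulled back to the compact second-countable
product of the sequence space with the unit interval, without topological properties of the
quotient. -/
theorem mkTiling_one_eq (T : X.TilingSpace fun _ => 1) :
    ∃ (x : X.seqs) (t : unitInterval), X.mkTiling (fun _ => 1) (x, t) = T := by
  obtain ⟨⟨x, t⟩, rfl⟩ := mkTiling_surjective T
  refine ⟨X.shiftBy ⌊t⌋ x, ⟨Int.fract t, Int.fract_nonneg t, (Int.fract_lt_one t).le⟩, ?_⟩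
  rw [← mkTiling_slide ⌊t⌋ (x, t)]
  simp only [slide, vertex, signedSum_const, mul_one, Int.self_sub_floor]

/-- In a plastic space every letter has a frequency, with bounded discrepancy. -/
theorem IsPlastic.exists_frequency (hX : X.IsPlastic) (φ : X.Alphabet → ℝ) :
    ∃ α C : ℝ, ∀ (x : X.seqs) (n : ℤ), |X.vertex φ x n - n * α| ≤ C := by
  obtain ⟨M, hM⟩ := exists_length_le φ
  have hM0 : 0 ≤ M := (abs_nonneg _).trans (hM ((Classical.arbitrary X.seqs).1 0))
  let L (s : ℝ) : X.Alphabet → ℝ := fun a => 1 + s * φ a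
  -- For `s` below this bound, |sφ| < 1 keeps the perturbed lengths positive.
  have hJ : (0 : ℝ) < 1 / (M + 1) := by positivity
  let J := Set.Ioo (0 : ℝ) (1 / (M + 1))
  have : Uncountable J := by
    rw [← Cardinal.aleph0_lt_mk_iff, Cardinal.mk_Ioo_real hJ]
    exact Cardinal.aleph0_lt_continuum
  have hL (s : J) (a : X.Alphabet) : 0 < L s a := by
    have h1 := abs_le.1 (hM a)
    have h2 := s.2.1
    have h3 := (lt_div_iff₀ (by positivity)).1 s.2.2
    simp only [L]
    nlinarith
  choose c hc h hh using fun s : J =>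
    hX (fun _ => 1) (L s) (fun _ => one_pos) (hL s)
  have hcL (s : J) (a : X.Alphabet) : 0 < (c s • L s) a := mul_pos (hc s) (hL s a)
  let q : X.seqs × unitInterval → X.TilingSpace fun _ => 1 :=
    fun p => X.mkTiling _ (p.1, p.2)
  have hq : Continuous q := continuous_mkTiling.comp (by fun_prop)
  obtain ⟨s, s', hne, hss⟩ := exists_ne_forall_exists_mem_inter
    (fun (s : J) i => (fun p => h s (q p)) ⁻¹' X.arc (c s • L s) i)
    (fun s i => (isOpen_arc i).preimage ((h s).continuous.comp hq))
    (fun s p => exists_mem_arc (hcL s) _)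
  obtain ⟨C, hC⟩ := abs_vertex_sub_le_of_close (hcL s) (hcL s') (h s) (h s') (hh s) (hh s')
    fun T => by
      obtain ⟨x, t, rfl⟩ := mkTiling_one_eq T
      exact hss (x, t)
  have hv (s : J) (x : X.seqs) (n : ℤ) :
      X.vertex (c s • L s) x n = c s * n + c s * s * X.vertex φ x n := by
    refine (signedSum_unique (s := fun n : ℤ => c s * n + c s * s * X.vertex φ x n) (by simp)
      (fun n => ?_) n).symm
    simp only [vertex, signedSum_add_one, Pi.smul_apply, smul_eq_mul, L]
    push_cast
    ring
  have hC' (x : X.seqs) (n : ℤ) :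
      |(c s * s - c s' * s') * X.vertex φ x n + n * (c s - c s')| ≤ C := by
    convert hC x n using 2
    rw [hv, hv]
    ring
  -- If the coefficient of φ vanished, boundedness in `n` would force `c s = c s'`, and then `s =
  -- s'`.
  have hD : c s * s - c s' * s' ≠ 0 := by
    intro h0
    have hcc : c s - c s' ≠ 0 := by
      intro h1
      have h2 : c s = c s' := by linarith
      rw [h2, ← mul_sub] at h0
      rcases mul_eq_zero.1 h0 with h3 | h3
      · exact (hc s').ne' h3
      · exact hne (Subtype.ext (by linarith))
    obtain ⟨n, hn⟩ := exists_nat_gt (C / |c s - c s'|)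
    rw [div_lt_iff₀ (abs_pos.2 hcc)] at hn
    have h2 := hC' (Classical.arbitrary X.seqs) n
    rw [h0, zero_mul, zero_add, abs_mul, Int.cast_natCast, Nat.abs_cast] at h2
    linarith
  refine ⟨-(c s - c s') / (c s * s - c s' * s'), C / |c s * s - c s' * s'|, fun x n => ?_⟩
  rw [le_div_iff₀ (abs_pos.2 hD), ← abs_mul]
  have e : (X.vertex φ x n - n * (-(c s - c s') / (c s * s - c s' * s'))) *
      (c s * s - c s' * s') = (c s * s - c s' * s') * X.vertex φ x n + n * (c s - c s') := by
    linear_combination (-(n : ℝ)) * div_mul_cancel₀ (-(c s - c s')) hD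
  rw [e]
  exact hC' x n

end SequenceSpace

/-! ### Functions with bounded discrepancy -/

/-- The Birkhoff sums of `ψ` are uniformly bounded. -/
def HasBoundedSums {α : Type*} (T : α → α) (ψ : α → ℝ) : Prop :=
  ∃ C, ∀ x n, |birkhoffSum T ψ n x| ≤ C

/-- The Birkhoff sums of `φ` differ by a bounded amount from those of a constant. -/
def HasBoundedDiscrepancy {α : Type*} (T : α → α) (φ : α → ℝ) : Prop :=
  ∃ c, HasBoundedSums T fun x => φ x - c

section Discrepancy

variable {α : Type*} {T : α → α} {φ ψ : α → ℝ}

theorem birkhoffSum_sub_const (φ : α → ℝ) (c : ℝ) (n : ℕ) (x : α) :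
    birkhoffSum T (fun y => φ y - c) n x = birkhoffSum T φ n x - n * c := by
  simp [birkhoffSum]

theorem HasBoundedSums.add (hφ : HasBoundedSums T φ) (hψ : HasBoundedSums T ψ) :
    HasBoundedSums T fun x => φ x + ψ x := by
  obtain ⟨C, hC⟩ := hφ
  obtain ⟨D, hD⟩ := hψ
  refine ⟨C + D, fun x n => ?_⟩
  have : birkhoffSum T (fun x => φ x + ψ x) n x = birkhoffSum T φ n x + birkhoffSum T ψ n x := by
    simp [birkhoffSum, Finset.sum_add_distrib]
  rw [this]
  exact (abs_add_le _ _).trans (add_le_add (hC x n) (hD x n))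

theorem HasBoundedSums.const_mul (hφ : HasBoundedSums T φ) (c : ℝ) :
    HasBoundedSums T fun x => c * φ x := by
  obtain ⟨C, hC⟩ := hφ
  refine ⟨|c| * C, fun x n => ?_⟩
  have : birkhoffSum T (fun x => c * φ x) n x = c * birkhoffSum T φ n x := by
    simp [birkhoffSum, Finset.mul_sum]
  rw [this, abs_mul]
  exact mul_le_mul_of_nonneg_left (hC x n) (abs_nonneg c)

theorem HasBoundedDiscrepancy.add (hφ : HasBoundedDiscrepancy T φ)
    (hψ : HasBoundedDiscrepancy T ψ) : HasBoundedDiscrepancy T fun x => φ x + ψ x := by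
  obtain ⟨c, hc⟩ := hφ
  obtain ⟨d, hd⟩ := hψ
  refine ⟨c + d, ?_⟩
  convert hc.add hd using 2
  ring

theorem HasBoundedDiscrepancy.const_mul (hφ : HasBoundedDiscrepancy T φ) (c : ℝ) :
    HasBoundedDiscrepancy T fun x => c * φ x := by
  obtain ⟨d, hd⟩ := hφ
  refine ⟨c * d, ?_⟩
  convert hd.const_mul c using 2
  ring

theorem hasBoundedDiscrepancy_const (c : ℝ) : HasBoundedDiscrepancy T fun _ => c :=
  ⟨c, 0, fun x n => by simp [birkhoffSum]⟩

theorem HasBoundedDiscrepancy.sum {ι : Type*} (s : Finset ι) {f : ι → α → ℝ}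
    (hf : ∀ i ∈ s, HasBoundedDiscrepancy T (f i)) :
    HasBoundedDiscrepancy T fun x => ∑ i ∈ s, f i x := by
  classical
  induction s using Finset.induction_on with
  | empty => simpa using hasBoundedDiscrepancy_const (T := T) 0
  | insert i s hi ih =>
    simp only [Finset.sum_insert hi]
    exact (hf i (Finset.mem_insert_self i s)).add
      (ih fun j hj => hf j (Finset.mem_insert_of_mem hj))

/-- A function has bounded discrepancy if and only if its Birkhoff sums of equal length at
different points differ by a bounded amount. -/
theorem hasBoundedDiscrepancy_iff [Nonempty α] {M : ℝ} (hM : ∀ x, |φ x| ≤ M) :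
    HasBoundedDiscrepancy T φ ↔
      ∃ C, ∀ x y n, |birkhoffSum T φ n x - birkhoffSum T φ n y| ≤ C := by
  constructor
  · rintro ⟨c, C, hC⟩
    refine ⟨2 * C, fun x y n => ?_⟩
    have hx := abs_le.1 (hC x n)
    have hy := abs_le.1 (hC y n)
    rw [birkhoffSum_sub_const] at hx hy
    rw [abs_le]
    constructor <;> linarith
  · rintro ⟨C, hC⟩
    let x₀ := Classical.arbitrary α
    let a (n : ℕ) : ℝ := birkhoffSum T φ n x₀
    have habs (n : ℕ) : |a n| ≤ n * M := by
      refine (Finset.abs_sum_le_sum_abs _ _).trans ?_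
      refine (Finset.sum_le_card_nsmul _ _ M fun i _ => hM _).trans ?_
      simp
    have hM0 : 0 ≤ M := (abs_nonneg _).trans (hM x₀)
    have hC0 : 0 ≤ C := (abs_nonneg _).trans (hC x₀ x₀ 0)
    have hadd (m n : ℕ) : |a (m + n) - a m - a n| ≤ C := by
      simp only [a]
      rw [birkhoffSum_add, add_sub_cancel_left]
      exact hC _ _ _
    -- `a` is additive up to `C`, so Fekete's lemma applies to both `a + C` and `-a + C`. The two
    -- limits are opposite, and bounding each from above by its quotients traps `a n` within `C` of
    -- a linear function.
    have hup : Subadditive fun n => a n + C := fun m n => by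
      have := (abs_le.1 (hadd m n)).2
      linarith
    have hdown : Subadditive fun n => -a n + C := fun m n => by
      have := (abs_le.1 (hadd m n)).1
      linarith
    have hbdd {b : ℕ → ℝ} (hb : ∀ n : ℕ, -(n * M) ≤ b n) :
        BddBelow (Set.range fun n : ℕ => b n / n) := by
      refine ⟨-M, ?_⟩
      rintro _ ⟨n, rfl⟩
      dsimp only
      -- At `n = 0` the quotient has the default value 0, which is at least `-M`.
      rcases n.eq_zero_or_pos with rfl | hn
      · simpa using hM0
      · have hn' : (0 : ℝ) < n := by exact_mod_cast hn
        rw [le_div_iff₀ hn']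
        linarith [hb n]
    have hb1 := hbdd (b := fun n => a n + C) fun n => by linarith [(abs_le.1 (habs n)).1]
    have hb2 := hbdd (b := fun n => -a n + C) fun n => by linarith [(abs_le.1 (habs n)).2]
    have hlim : hup.lim = -hdown.lim := by
      have h1 := hup.tendsto_lim hb1
      have h2 := (hdown.tendsto_lim hb2).neg
      have h3 : Filter.Tendsto (fun n : ℕ => 2 * C / (n : ℝ)) Filter.atTop (nhds 0) :=
        tendsto_const_div_atTop_nhds_zero_nat _
      have h4 := h1.sub h3
      rw [sub_zero] at h4
      refine tendsto_nhds_unique h4 (h2.congr fun n => ?_)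
      ring
    refine ⟨hup.lim, 2 * C, fun x n => ?_⟩
    rw [birkhoffSum_sub_const]
    have hx := abs_le.1 (hC x x₀ n)
    rcases n.eq_zero_or_pos with rfl | hn
    · simpa using hC0
    · have hn' : (0 : ℝ) < n := by exact_mod_cast hn
      have h1 := hup.lim_le_div hb1 hn.ne'
      have h2 := hdown.lim_le_div hb2 hn.ne'
      rw [le_div_iff₀ hn'] at h1 h2
      have h3 : hdown.lim = -hup.lim := by linarith
      rw [h3] at h2
      simp only [a] at h1 h2
      rw [abs_le]
      constructor <;> linarith

/-- If `c ≤ 0`, the sums of `φ - c` would grow at least like `n * ε`. This makes mean lengths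
positive. -/
theorem HasBoundedSums.pos_of_le [Nonempty α] {c ε : ℝ}
    (h : HasBoundedSums T fun x => φ x - c) (hε : 0 < ε) (hφ : ∀ x, ε ≤ φ x) : 0 < c := by
  obtain ⟨C, hC⟩ := h
  by_contra! hc
  obtain ⟨n, hn⟩ := exists_nat_gt (C / ε)
  rw [div_lt_iff₀ hε] at hn
  let x₀ := Classical.arbitrary α
  have h1 : (n : ℝ) * ε ≤ birkhoffSum T (fun x => φ x - c) n x₀ := by
    have := Finset.card_nsmul_le_sum (Finset.range n) (fun k => φ (T^[k] x₀) - c) ε fun k _ => by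
      linarith [hφ (T^[k] x₀)]
    simpa [birkhoffSum] using this
  linarith [(abs_le.1 (hC x₀ n)).2]

theorem Function.Semiconj.birkhoffSum_comp {β : Type*} {S : β → β} {G : α → β}
    (h : Function.Semiconj G T S) (f : β → ℝ) (n : ℕ) (x : α) :
    birkhoffSum T (fun y => f (G y)) n x = birkhoffSum S f n (G x) := by
  simp only [birkhoffSum, fun k => (h.iterate_right k).eq x]

theorem HasBoundedDiscrepancy.comp_semiconj {β : Type*} {S : β → β} {G : α → β} {f : β → ℝ}
    (hf : HasBoundedDiscrepancy S f) (h : Function.Semiconj G T S) :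
    HasBoundedDiscrepancy T fun x => f (G x) := by
  obtain ⟨c, C, hC⟩ := hf
  exact ⟨c, C, fun x n => by
    rw [h.birkhoffSum_comp fun y => f y - c]
    exact hC _ _⟩

end Discrepancy

namespace SequenceSpace

variable {X : SequenceSpace.{u}}

/-! ### Balance of words -/

/-- The word of length `n` of `x` starting at the origin. -/
def word (X : SequenceSpace.{u}) (x : X.seqs) (n : ℕ) : List X.Alphabet :=
  (List.range n).map fun i : ℕ => x.1 i

@[simp] theorem length_word (x : X.seqs) (n : ℕ) : (X.word x n).length = n := by simp [word]

theorem mem_language_iff {w : List X.Alphabet} :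
    w ∈ X.language ↔ ∃ x : X.seqs, X.word x w.length = w := by
  constructor
  · rintro ⟨x, hx, k, n, rfl⟩
    exact ⟨X.shiftBy k ⟨x, hx⟩, by simp [word]⟩
  · rintro ⟨x, hx⟩
    exact ⟨x.1, x.2, 0, w.length, by simpa [word] using hx.symm⟩

theorem word_mem_language (x : X.seqs) (n : ℕ) : X.word x n ∈ X.language :=
  mem_language_iff.2 ⟨x, by rw [length_word]⟩

theorem prefix_drop_word_iff (w : List X.Alphabet) (x : X.seqs) (n i : ℕ) (hi : i ≤ n) :
    w <+: (X.word x n).drop i ↔ i + w.length ≤ n ∧ X.word (X.shiftBy i x) w.length = w := by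
  have key : i + w.length ≤ n →
      ((X.word x n).drop i).take w.length = X.word (X.shiftBy i x) w.length := by
    intro h
    refine List.ext_getElem (by simp; omega) fun j h1 h2 => ?_
    simp [word]
  rw [List.prefix_iff_eq_take]
  constructor
  · intro h
    have hl : i + w.length ≤ n := by
      have := congrArg List.length h
      simp only [List.length_take, List.length_drop, length_word] at this
      omega
    exact ⟨hl, by rw [← key hl, ← h]⟩
  · rintro ⟨hl, h⟩
    rw [key hl, h]

open Classical in
/-- The indicator function of the sequences in which `w` can be read at the origin. -/
noncomputable def reads (X : SequenceSpace.{u}) (w : List X.Alphabet) (x : X.seqs) : ℝ :=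
  if X.word x w.length = w then 1 else 0

theorem abs_reads_le (w : List X.Alphabet) (x : X.seqs) : |X.reads w x| ≤ 1 := by
  unfold reads; split_ifs <;> simp

/-- The Birkhoff sum also counts occurrences that start in the word but run past its end, at most
`w.length` of them. It misses position `n`, which counts only for the empty word. -/
theorem abs_occurrences_sub_le (w : List X.Alphabet) (x : X.seqs) (n : ℕ) :
    |(occurrences w (X.word x n) : ℝ) - birkhoffSum X.sigma (X.reads w) n x| ≤ w.length + 1 := by
  classical
  let P (i : ℕ) : Prop := X.word (X.shiftBy i x) w.length = w
  have hS : birkhoffSum X.sigma (X.reads w) n x = ((Finset.range n).filter P).card := by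
    simp only [birkhoffSum, sigma_iterate, reads, Finset.sum_boole, P]
  have hO : occurrences w (X.word x n) =
      ((Finset.range (n + 1)).filter fun i => i + w.length ≤ n ∧ P i).card := by
    unfold occurrences
    rw [length_word]
    congr 1
    ext i
    simp only [Finset.mem_filter, Finset.mem_range]
    exact and_congr_right fun hi => prefix_drop_word_iff w x n i (Nat.le_of_lt_succ hi)
  have h1 : occurrences w (X.word x n) ≤ ((Finset.range n).filter P).card + 1 := by
    rw [hO, ← Finset.card_singleton n]
    refine (Finset.card_le_card ?_).trans (Finset.card_union_le _ _)
    intro i hi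
    simp only [Finset.mem_filter, Finset.mem_range, Finset.mem_union, Finset.mem_singleton] at hi ⊢
    rcases Nat.lt_succ_iff_lt_or_eq.1 hi.1 with h | h
    · exact Or.inl ⟨h, hi.2.2⟩
    · exact Or.inr h
  have h2 : ((Finset.range n).filter P).card ≤ occurrences w (X.word x n) + w.length := by
    rw [hO]
    have : (Finset.Ico (n - w.length) n).card ≤ w.length := by
      rw [Nat.card_Ico]; omega
    refine (Finset.card_le_card ?_).trans ((Finset.card_union_le _ _).trans
      (Nat.add_le_add_left this _))
    intro i hi
    simp only [Finset.mem_filter, Finset.mem_range, Finset.mem_union, Finset.mem_Ico] at hi ⊢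
    by_cases h : i + w.length ≤ n
    · exact Or.inl ⟨by omega, h, hi.2⟩
    · exact Or.inr ⟨by omega, hi.1⟩
  rw [hS, abs_le]
  have h1' : (occurrences w (X.word x n) : ℝ) ≤ ((Finset.range n).filter P).card + 1 := by
    exact_mod_cast h1
  have h2' : (((Finset.range n).filter P).card : ℝ) ≤ occurrences w (X.word x n) + w.length := by
    exact_mod_cast h2
  have h3 : (0 : ℝ) ≤ w.length := Nat.cast_nonneg _
  constructor <;> linarith

theorem setOf_occurrences_eq (w : List X.Alphabet) (n : ℕ) :
    {k | ∃ v ∈ X.language, v.length = n ∧ occurrences w v = k} =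
      Set.range fun x : X.seqs => occurrences w (X.word x n) := by
  ext k
  constructor
  · rintro ⟨v, hv, rfl, rfl⟩
    obtain ⟨x, hx⟩ := mem_language_iff.1 hv
    exact ⟨x, by rw [← hx, length_word]⟩
  · rintro ⟨x, rfl⟩
    exact ⟨_, word_mem_language x n, length_word x n, rfl⟩

theorem bddAbove_occurrences (w : List X.Alphabet) (n : ℕ) :
    BddAbove (Set.range fun x : X.seqs => occurrences w (X.word x n)) := by
  refine ⟨n + 1, ?_⟩
  rintro _ ⟨x, rfl⟩
  classical
  simp only [occurrences]
  exact (Finset.card_filter_le _ _).trans (by simp)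

/-- Balance of a word in terms of Birkhoff sums. -/
theorem balanced_word_iff (w : List X.Alphabet) :
    (∃ C : ℤ, ∀ n : ℕ, 0 < n → (X.maxOcc w n : ℤ) - X.minOcc w n < C) ↔
      HasBoundedDiscrepancy X.sigma (X.reads w) := by
  rw [hasBoundedDiscrepancy_iff (abs_reads_le w)]
  have hmin (n : ℕ) : X.minOcc w n = sInf (Set.range fun x => occurrences w (X.word x n)) := by
    rw [minOcc, setOf_occurrences_eq]
  have hmax (n : ℕ) : X.maxOcc w n = sSup (Set.range fun x => occurrences w (X.word x n)) := by
    rw [maxOcc, setOf_occurrences_eq]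
  constructor
  · rintro ⟨C, hC⟩
    have hlt (x y : X.seqs) (n : ℕ) (hn : 0 < n) :
        (occurrences w (X.word x n) : ℝ) - occurrences w (X.word y n) < C := by
      have h1 : occurrences w (X.word x n) ≤ X.maxOcc w n := by
        rw [hmax]; exact le_csSup (bddAbove_occurrences w n) ⟨x, rfl⟩
      have h2 : X.minOcc w n ≤ occurrences w (X.word y n) := by
        rw [hmin]; exact Nat.sInf_le ⟨y, rfl⟩
      have h3 : (occurrences w (X.word x n) : ℤ) - occurrences w (X.word y n) < C := by
        have := hC n hn
        omega
      exact_mod_cast h3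
    refine ⟨|(C : ℝ)| + 2 * (w.length + 1), fun x y n => ?_⟩
    rcases n.eq_zero_or_pos with rfl | hn
    · simp only [birkhoffSum_zero, sub_zero, abs_zero]; positivity
    · have hx := abs_le.1 (abs_occurrences_sub_le w x n)
      have hy := abs_le.1 (abs_occurrences_sub_le w y n)
      have h1 := hlt x y n hn
      have h2 := hlt y x n hn
      have h3 := le_abs_self (C : ℝ)
      rw [abs_le]
      constructor <;> linarith
  · rintro ⟨C, hC⟩
    refine ⟨⌈C⌉ + 2 * (w.length + 1) + 1, fun n _ => ?_⟩
    have hne : (Set.range fun x : X.seqs => occurrences w (X.word x n)).Nonempty :=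
      Set.range_nonempty _
    obtain ⟨x, hx⟩ := Nat.sInf_mem hne
    obtain ⟨y, hy⟩ := Nat.sSup_mem hne (bddAbove_occurrences w n)
    rw [hmin, hmax, ← hx, ← hy]
    have h1 := abs_le.1 (abs_occurrences_sub_le w x n)
    have h2 := abs_le.1 (abs_occurrences_sub_le w y n)
    have h3 := abs_le.1 (hC y x n)
    have h4 := Int.le_ceil C
    have h5 : ((occurrences w (X.word y n) : ℤ) - (occurrences w (X.word x n) : ℤ) : ℝ) <
        ((⌈C⌉ + 2 * (w.length + 1) + 1 : ℤ) : ℝ) := by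
      push_cast
      linarith
    exact_mod_cast h5

theorem finitelyBalanced_iff :
    X.FinitelyBalanced ↔ ∀ a, HasBoundedDiscrepancy X.sigma (X.reads [a]) := by
  constructor
  · rintro ⟨C, hC⟩ a
    exact (balanced_word_iff [a]).1 ⟨C, hC a⟩
  · intro h
    choose C hC using fun a => (balanced_word_iff [a]).2 (h a)
    obtain ⟨M, hM⟩ := (Set.finite_range C).bddAbove
    exact ⟨M, fun a n hn => (hC a n hn).trans_le (hM ⟨a, rfl⟩)⟩

theorem totallyFinitelyBalanced_iff :
    X.TotallyFinitelyBalanced ↔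
      ∀ w ∈ X.language, HasBoundedDiscrepancy X.sigma (X.reads w) :=
  forall₂_congr fun w _ => balanced_word_iff w

theorem reads_eq_zero {w : List X.Alphabet} (hw : w ∉ X.language) : X.reads w = fun _ => 0 := by
  ext x
  exact if_neg fun h => hw (mem_language_iff.2 ⟨x, h⟩)

theorem TotallyFinitelyBalanced.reads (hX : X.TotallyFinitelyBalanced) (w : List X.Alphabet) :
    HasBoundedDiscrepancy X.sigma (X.reads w) := by
  by_cases hw : w ∈ X.language
  · exact totallyFinitelyBalanced_iff.1 hX w hw
  · rw [reads_eq_zero hw]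
    exact hasBoundedDiscrepancy_const 0

open Classical in
theorem reads_singleton (a : X.Alphabet) (x : X.seqs) :
    X.reads [a] x = if x.1 0 = a then 1 else 0 := by
  simp [SequenceSpace.reads, word]

theorem IsPlastic.hasBoundedDiscrepancy (hX : X.IsPlastic) (φ : X.Alphabet → ℝ) :
    HasBoundedDiscrepancy X.sigma fun x => φ (x.1 0) := by
  obtain ⟨c, C, hC⟩ := hX.exists_frequency φ
  refine ⟨c, C, fun x n => ?_⟩
  rw [birkhoffSum_sub_const, ← vertex_natCast]
  exact_mod_cast hC x n

theorem IsPlastic.finitelyBalanced (hX : X.IsPlastic) : X.FinitelyBalanced := by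
  classical
  refine finitelyBalanced_iff.2 fun a => ?_
  convert hX.hasBoundedDiscrepancy fun b => if b = a then 1 else 0 using 1
  ext x
  rw [reads_singleton]

end SequenceSpace

namespace SequenceSpace

variable {X : SequenceSpace.{u}}

/-! ### Minimality and coboundaries -/

theorem shiftBy_mem_iff {Z : Set X.seqs} (hZ : ∀ x, X.sigma x ∈ Z ↔ x ∈ Z) (n : ℤ) (x : X.seqs) :
    X.shiftBy n x ∈ Z ↔ x ∈ Z := by
  induction n using Int.induction_on with
  | zero => simp
  | succ i ih => rw [← ih, ← hZ (X.shiftBy i x), sigma_eq_shiftBy, shiftBy_shiftBy]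
  | pred i ih => rw [← ih, ← hZ, sigma_eq_shiftBy, shiftBy_shiftBy, sub_add_cancel]

/-- Minimality in terms of invariant closed subsets of the space itself. -/
theorem isMinimal_iff : X.IsMinimal ↔ ∀ Z : Set X.seqs, IsClosed Z → Z.Nonempty →
    (∀ x, X.sigma x ∈ Z ↔ x ∈ Z) → Z = Set.univ := by
  have hcl : IsClosed X.seqs := X.toSubshift.isClosed
  constructor
  · intro h Z hZ hne hinv
    let S : Subshift X.Alphabet ℤ :=
      { carrier := Subtype.val '' Z
        isClosed := hcl.isClosedMap_subtype_val Z hZ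
        mapsTo := by
          rintro n _ ⟨x, hx, rfl⟩
          exact ⟨X.shiftBy n x, (shiftBy_mem_iff hinv n x).2 hx, rfl⟩ }
    have hS := h S (hne.image _) (by rintro _ ⟨x, _, rfl⟩; exact x.2)
    refine Set.eq_univ_of_forall fun x => ?_
    obtain ⟨y, hy, hyx⟩ := hS.ge x.2
    rwa [← Subtype.ext hyx]
  · intro h S hne hsub
    have hZ := h (Subtype.val ⁻¹' S.carrier) (S.isClosed.preimage continuous_subtype_val)
      (by obtain ⟨x, hx⟩ := hne; exact ⟨⟨x, hsub hx⟩, hx⟩) fun x => by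
        refine ⟨fun hx => ?_, fun hx => S.mapsTo 1 hx⟩
        have := S.mapsTo (-1) hx
        change (X.shiftBy (-1) (X.shiftBy 1 x)).1 ∈ S.carrier at this
        rwa [shiftBy_shiftBy, add_neg_cancel, shiftBy_zero] at this
    exact hsub.antisymm fun x hx => hZ.ge (Set.mem_univ (⟨x, hx⟩ : X.seqs))

theorem exists_abs_vertex_le {v : X.Alphabet → ℝ}
    (h : HasBoundedSums X.sigma fun x => v (x.1 0)) :
    ∃ C, ∀ (x : X.seqs) (n : ℤ), |X.vertex v x n| ≤ C := by
  obtain ⟨C, hC⟩ := h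
  refine ⟨C, fun x n => ?_⟩
  obtain ⟨k, rfl | rfl⟩ := n.eq_nat_or_neg
  · rw [vertex_natCast]; exact hC x k
  · have h1 := vertex_shiftBy (ℓ := v) x (-(k : ℤ)) k
    rw [neg_add_cancel, vertex_zero, zero_sub] at h1
    rw [← abs_neg, ← h1, vertex_natCast]
    exact hC _ k

/-- The Gottschalk–Hedlund theorem for functions of one letter. -/
theorem IsMinimal.exists_coboundary (hX : X.IsMinimal) {v : X.Alphabet → ℝ}
    (hv : HasBoundedSums X.sigma fun x => v (x.1 0)) :
    ∃ b : X.seqs → ℝ, Continuous b ∧ ∀ x, b (X.sigma x) = b x + v (x.1 0) := by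
  obtain ⟨C, hC⟩ := exists_abs_vertex_le hv
  have hup (x : X.seqs) : BddAbove (Set.range fun n => X.vertex v x n) :=
    ⟨C, by rintro _ ⟨n, rfl⟩; exact (abs_le.1 (hC x n)).2⟩
  have hlow (x : X.seqs) : BddBelow (Set.range fun n => X.vertex v x n) :=
    ⟨-C, by rintro _ ⟨n, rfl⟩; exact (abs_le.1 (hC x n)).1⟩
  -- Shifting rebases the sums at the next vertex, so supremum and infimum both drop by `v (x.1 0)`.
  -- Hence `-g` solves the equation, `g - i` is invariant, and only continuity of `g` is at stake.
  let g (x : X.seqs) : ℝ := ⨆ n : ℤ, X.vertex v x n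
  let i (x : X.seqs) : ℝ := ⨅ n : ℤ, X.vertex v x n
  have hstep (x : X.seqs) (n : ℤ) :
      X.vertex v (X.sigma x) n = X.vertex v x (1 + n) - v (x.1 0) := by
    rw [sigma_eq_shiftBy, vertex_shiftBy, vertex_one]
  have hg (x : X.seqs) : g (X.sigma x) = g x - v (x.1 0) := by
    simp only [g, hstep]
    refine (ciSup_sub (f := fun n => X.vertex v x (1 + n))
      ((hup x).mono (Set.range_comp_subset_range (fun n => 1 + n) _)) _).symm.trans ?_
    congr 1
    exact (Equiv.addLeft (1 : ℤ)).iSup_comp (g := fun n => X.vertex v x n)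
  have hi (x : X.seqs) : i (X.sigma x) = i x - v (x.1 0) := by
    simp only [i, hstep]
    refine (ciInf_sub (f := fun n => X.vertex v x (1 + n))
      ((hlow x).mono (Set.range_comp_subset_range (fun n => 1 + n) _)) _).symm.trans ?_
    congr 1
    exact (Equiv.addLeft (1 : ℤ)).iInf_comp (g := fun n => X.vertex v x n)
  have hgl : LowerSemicontinuous g :=
    lowerSemicontinuous_ciSup hup fun n => (continuous_vertex n).lowerSemicontinuous
  have hiu : UpperSemicontinuous i :=
    upperSemicontinuous_ciInf hlow fun n => (continuous_vertex n).upperSemicontinuous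
  have hD : LowerSemicontinuous fun x => g x + -i x := hgl.add hiu.neg
  -- Sublevel sets of the invariant lower semicontinuous function `g - i` are closed and invariant.
  -- By minimality `g - i` is constant.
  have hle (x₀ x : X.seqs) : g x + -i x ≤ g x₀ + -i x₀ := by
    have := isMinimal_iff.1 hX {x | g x + -i x ≤ g x₀ + -i x₀}
      (hD.isClosed_preimage _) ⟨x₀, le_refl (g x₀ + -i x₀)⟩ fun x => by
        simp only [Set.mem_ofPred_eq, hg, hi]
        ring_nf
    exact this.ge (Set.mem_univ x)
  let x₀ := Classical.arbitrary X.seqs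
  have hgi : g = fun x => i x + (g x₀ + -i x₀) := by
    ext x
    linarith [hle x₀ x, hle x x₀]
  -- Being a constant plus `i`, the function `g` is upper semicontinuous as well.
  have hgc : Continuous g := continuous_iff_lower_upperSemicontinuous.2 ⟨hgl, by
    rw [hgi]
    exact hiu.add continuous_const.upperSemicontinuous⟩
  exact ⟨fun x => -g x, hgc.neg, fun x => by simp only [hg]; ring⟩

/-- Moving the origin by `b`, which commutes with translations. -/
def moveOrigin {ℓ m : X.Alphabet → ℝ} (b : X.seqs → ℝ)
    (hb : ∀ x, b (X.sigma x) = b x + (ℓ (x.1 0) - m (x.1 0))) :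
    X.TilingSpace ℓ → X.TilingSpace m :=
  Quot.map (fun p => (p.1, p.2 + b p.1)) (by
    rintro ⟨x, t⟩ q rfl
    simp only [Glue, Prod.mk.injEq, true_and, hb]
    ring)

theorem continuous_moveOrigin {ℓ m : X.Alphabet → ℝ} {b : X.seqs → ℝ} (hbc : Continuous b)
    (hb : ∀ x, b (X.sigma x) = b x + (ℓ (x.1 0) - m (x.1 0))) :
    Continuous (moveOrigin b hb) := by
  refine continuous_quot_lift _ ?_
  exact continuous_mkTiling.comp
    (continuous_fst.prodMk (continuous_snd.add (hbc.comp continuous_fst)))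

/-- Cohomologous length functions give conjugate spaces; moving the origin by `-b` is the inverse
map. -/
theorem conjugate_of_coboundary {ℓ m : X.Alphabet → ℝ} {b : X.seqs → ℝ} (hbc : Continuous b)
    (hb : ∀ x, b (X.sigma x) = b x + (ℓ (x.1 0) - m (x.1 0))) : X.Conjugate ℓ m := by
  have hb' (x : X.seqs) : -b (X.sigma x) = -b x + (m (x.1 0) - ℓ (x.1 0)) := by
    rw [hb]; ring
  refine ⟨{ toFun := moveOrigin b hb
            invFun := moveOrigin (fun x => -b x) hb'
            left_inv := ?_
            right_inv := ?_
            continuous_toFun := continuous_moveOrigin hbc hb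
            continuous_invFun := continuous_moveOrigin hbc.neg hb' }, ?_⟩
  · rintro ⟨x, t⟩
    change X.mkTiling ℓ (x, t + b x + -b x) = X.mkTiling ℓ (x, t)
    rw [add_neg_cancel_right]
  · rintro ⟨x, t⟩
    change X.mkTiling m (x, t + -b x + b x) = X.mkTiling m (x, t)
    rw [neg_add_cancel_right]
  · rintro s ⟨x, t⟩
    change X.mkTiling m (x, t + s + b x) = X.mkTiling m (x, t + b x + s)
    rw [add_right_comm]

theorem FinitelyBalanced.hasBoundedDiscrepancy (hX : X.FinitelyBalanced) (φ : X.Alphabet → ℝ) :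
    HasBoundedDiscrepancy X.sigma fun x => φ (x.1 0) := by
  classical
  have := Fintype.ofFinite X.Alphabet
  convert HasBoundedDiscrepancy.sum Finset.univ
    fun a _ => (finitelyBalanced_iff.1 hX a).const_mul (φ a) using 1
  ext x
  simp [reads_singleton]

theorem IsMinimal.isPlastic (hX : X.IsMinimal) (hbal : X.FinitelyBalanced) : X.IsPlastic := by
  intro ℓ ℓ' hℓ hℓ'
  obtain ⟨α, hα⟩ := hbal.hasBoundedDiscrepancy ℓ
  obtain ⟨β, hβ⟩ := hbal.hasBoundedDiscrepancy ℓ'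
  obtain ⟨ε, hε, hle⟩ := exists_pos_le_length hℓ
  obtain ⟨ε', hε', hle'⟩ := exists_pos_le_length hℓ'
  have hα0 := hα.pos_of_le hε fun x => hle (x.1 0)
  have hβ0 := hβ.pos_of_le hε' fun x => hle' (x.1 0)
  -- This scale equalises the mean tile lengths α and β, so the constants cancel in the difference.
  refine ⟨α / β, div_pos hα0 hβ0, ?_⟩
  have h := hα.add (hβ.const_mul (-(α / β)))
  obtain ⟨b, hbc, hb⟩ := hX.exists_coboundary (v := fun a => ℓ a - (α / β) * ℓ' a) (by
    convert h using 2
    field_simp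
    ring)
  exact conjugate_of_coboundary hbc hb

end SequenceSpace

/-! ### Towers -/

/-- There is no proper nonempty closed invariant subset. -/
def IsMinimalMap {α : Type*} [TopologicalSpace α] (T : α → α) : Prop :=
  ∀ Z : Set α, IsClosed Z → Z.Nonempty → (∀ x, T x ∈ Z ↔ x ∈ Z) → Z = Set.univ

/-- All locally constant functions have bounded discrepancy. -/
def IsTotallyBalancedMap {α : Type*} [TopologicalSpace α] (T : α → α) : Prop :=
  ∀ φ : α → ℝ, IsLocallyConstant φ → HasBoundedDiscrepancy T φ

/-- The map `S` is the tower of height `p` over `T`, whose base is embedded by `G`. -/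
structure IsTower {α β : Type*} [TopologicalSpace α] [TopologicalSpace β] (T : α → α) (S : β → β)
    (G : α → β) (p : α → ℕ) : Prop where
  continuous_map : Continuous S
  continuous_base : Continuous G
  isLocallyConstant_height : IsLocallyConstant p
  height_pos : ∀ x, 0 < p x
  map_base : ∀ x, G (T x) = S^[p x] (G x)
  unique : ∀ x x' j j', j < p x → j' < p x' → S^[j] (G x) = S^[j'] (G x') → x = x' ∧ j = j'
  exists_eq : ∀ y, ∃ x, ∃ j < p x, S^[j] (G x) = y

namespace IsTower

variable {α β : Type*} [TopologicalSpace α] [TopologicalSpace β] {T : α → α} {S : β → β}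
  {G : α → β} {p : α → ℕ}

theorem base_injective (h : IsTower T S G p) : Function.Injective G := fun x x' hx =>
  (h.unique x x' 0 0 (h.height_pos x) (h.height_pos x') hx).1

theorem base_iterate (h : IsTower T S G p) (k : ℕ) (x : α) :
    G (T^[k] x) = S^[birkhoffSum T p k x] (G x) := by
  induction k with
  | zero => simp
  | succ k ih =>
    rw [Function.iterate_succ_apply', h.map_base, ih, birkhoffSum_succ, add_comm,
      Function.iterate_add_apply]

/-- The sum of `φ` over the levels of the tower above a point of the base. -/
theorem birkhoffSum_base (h : IsTower T S G p) (φ : β → ℝ) (k : ℕ) (x : α) :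
    birkhoffSum T (fun x => birkhoffSum S φ (p x) (G x)) k x =
      birkhoffSum S φ (birkhoffSum T p k x) (G x) := by
  induction k with
  | zero => simp
  | succ k ih => rw [birkhoffSum_succ, ih, birkhoffSum_succ, birkhoffSum_add, h.base_iterate]

theorem exists_birkhoffSum_le_lt (h : IsTower T S G p) (x : α) (n : ℕ) :
    ∃ k, birkhoffSum T p k x ≤ n ∧ n < birkhoffSum T p (k + 1) x := by
  induction n with
  | zero => exact ⟨0, by simp, by simpa using h.height_pos x⟩
  | succ n ih =>
    obtain ⟨k, h1, h2⟩ := ih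
    rcases (Nat.succ_le_of_lt h2).lt_or_eq with h3 | h3
    · exact ⟨k, h1.trans n.le_succ, h3⟩
    · refine ⟨k + 1, h3.ge, ?_⟩
      rw [birkhoffSum_succ _ _ (k + 1)]
      have := h.height_pos (T^[k + 1] x)
      omega

theorem hasBoundedSums_base (h : IsTower T S G p) {φ : β → ℝ} (hφ : HasBoundedSums S φ) :
    HasBoundedSums T fun x => birkhoffSum S φ (p x) (G x) := by
  obtain ⟨C, hC⟩ := hφ
  exact ⟨C, fun x n => by rw [h.birkhoffSum_base]; exact hC _ _⟩

theorem exists_height_le [CompactSpace α] (h : IsTower T S G p) : ∃ P, ∀ x, p x ≤ P := by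
  obtain ⟨P, hP⟩ := h.isLocallyConstant_height.range_finite.bddAbove
  exact ⟨P, fun x => hP ⟨x, rfl⟩⟩

/-- An orbit segment of `S`, extended backwards to the base, is a union of full columns plus an
incomplete one. The added start and the incomplete end each contribute at most `P * M`. -/
theorem hasBoundedSums_of_base [CompactSpace α] (h : IsTower T S G p) {φ : β → ℝ} {M : ℝ}
    (hM : ∀ y, |φ y| ≤ M) (hφ : HasBoundedSums T fun x => birkhoffSum S φ (p x) (G x)) :
    HasBoundedSums S φ := by
  obtain ⟨C, hC⟩ := hφ
  obtain ⟨P, hP⟩ := h.exists_height_le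
  refine ⟨C + P * M + P * M, fun y n => ?_⟩
  have hM0 : 0 ≤ M := (abs_nonneg _).trans (hM y)
  have hshort (r : ℕ) (hr : r ≤ P) (z : β) : |birkhoffSum S φ r z| ≤ P * M := by
    refine (Finset.abs_sum_le_sum_abs _ _).trans ?_
    refine (Finset.sum_le_card_nsmul _ _ M fun i _ => hM _).trans ?_
    rw [Finset.card_range, nsmul_eq_mul]
    exact mul_le_mul_of_nonneg_right (by exact_mod_cast hr) hM0
  obtain ⟨x, j, hj, rfl⟩ := h.exists_eq y
  obtain ⟨k, h1, h2⟩ := h.exists_birkhoffSum_le_lt x (j + n)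
  obtain ⟨r, hr⟩ := Nat.exists_eq_add_of_le h1
  rw [birkhoffSum_succ, hr, Nat.add_lt_add_iff_left] at h2
  have e1 := birkhoffSum_add S φ j n (G x)
  rw [hr, birkhoffSum_add, ← h.birkhoffSum_base] at e1
  have b1 := abs_le.1 (hC x k)
  have b2 := abs_le.1 (hshort r (h2.le.trans (hP _)) (S^[birkhoffSum T p k x] (G x)))
  have b3 := abs_le.1 (hshort j (hj.le.trans (hP x)) (G x))
  rw [abs_le]
  constructor <;> linarith

theorem isLocallyConstant_base (h : IsTower T S G p) {φ : β → ℝ} (hφ : IsLocallyConstant φ) :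
    IsLocallyConstant fun x => birkhoffSum S φ (p x) (G x) := by
  rw [IsLocallyConstant.iff_eventually_eq]
  intro x
  have hk (k : ℕ) : ∀ᶠ x' in nhds x, φ (S^[k] (G x')) = φ (S^[k] (G x)) :=
    (hφ.comp_continuous ((h.continuous_map.iterate k).comp h.continuous_base)).eventually_eq x
  have hall := (Filter.eventually_all_finset (Finset.range (p x))).2 fun k _ => hk k
  filter_upwards [h.isLocallyConstant_height.eventually_eq x, hall] with x' h1 h2
  rw [h1]
  exact Finset.sum_congr rfl h2

/-- With `a` the mean column sum of `φ` and `b` the mean height, the mean of `φ` per step of `S`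
must be `a / b`; subtracting it makes the column sums have bounded sums. -/
theorem isTotallyBalancedMap [CompactSpace α] [CompactSpace β] [Nonempty α]
    (h : IsTower T S G p) (hT : IsTotallyBalancedMap T) : IsTotallyBalancedMap S := by
  intro φ hφ
  obtain ⟨a, ha⟩ := hT _ (h.isLocallyConstant_base hφ)
  obtain ⟨b, hb⟩ := hT (fun x => (p x : ℝ)) (h.isLocallyConstant_height.comp _)
  have hb0 : 0 < b := hb.pos_of_le one_pos fun x => by exact_mod_cast h.height_pos x
  obtain ⟨M, hM⟩ := (hφ.range_finite.image fun t => |t - a / b|).bddAbove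
  refine ⟨a / b, h.hasBoundedSums_of_base (M := M) (fun y => hM ⟨_, ⟨y, rfl⟩, rfl⟩) ?_⟩
  convert ha.add (hb.const_mul (-(a / b))) using 2 with x
  rw [birkhoffSum_sub_const]
  field_simp
  ring

/-- A finite union of compact images. The case `m = 0` gives the full columns over `Z`; `m = 1`
gives the complement of the base when `Z` is everything. -/
theorem isClosed_levels [CompactSpace α] [T2Space β] (h : IsTower T S G p) {Z : Set α}
    (hZ : IsClosed Z) (m : ℕ) : IsClosed {y | ∃ x ∈ Z, ∃ j, m ≤ j ∧ j < p x ∧ S^[j] (G x) = y} := by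
  obtain ⟨P, hP⟩ := h.exists_height_le
  have : {y | ∃ x ∈ Z, ∃ j, m ≤ j ∧ j < p x ∧ S^[j] (G x) = y} =
      ⋃ j ∈ Set.Ico m P, (fun x => S^[j] (G x)) '' (Z ∩ p ⁻¹' Set.Ioi j) := by
    ext y
    simp only [Set.mem_iUnion, Set.mem_image]
    constructor
    · rintro ⟨x, hx, j, hm, hj, rfl⟩
      exact ⟨j, ⟨hm, hj.trans_le (hP x)⟩, x, ⟨hx, hj⟩, rfl⟩
    · rintro ⟨j, ⟨hm, -⟩, x, ⟨hx, hj⟩, rfl⟩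
      exact ⟨x, hx, j, hm, hj, rfl⟩
  rw [this]
  refine (Set.finite_Ico m P).isClosed_biUnion fun j _ => ?_
  exact ((hZ.inter ((isClosed_discrete _).preimage h.isLocallyConstant_height.continuous)).isCompact.image
    ((h.continuous_map.iterate j).comp h.continuous_base)).isClosed

/-- The complement of the base consists of the levels from 1 on and is closed. So the base is
clopen, and locally constant functions on it extend by zero. -/
theorem isOpenEmbedding_base [CompactSpace α] [T2Space β] (h : IsTower T S G p) :
    Topology.IsOpenEmbedding G := by
  refine ⟨(h.continuous_base.isClosedEmbedding h.base_injective).isEmbedding, ?_⟩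
  rw [← isClosed_compl_iff]
  convert h.isClosed_levels isClosed_univ 1 using 1
  ext y
  constructor
  · intro hy
    obtain ⟨x, j, hj, rfl⟩ := h.exists_eq y
    refine ⟨x, trivial, j, Nat.one_le_iff_ne_zero.2 ?_, hj, rfl⟩
    rintro rfl
    exact hy ⟨x, rfl⟩
  · rintro ⟨x, -, j, h1, hj, rfl⟩ ⟨x', hx'⟩
    have := (h.unique x' x 0 j (h.height_pos x') hj hx').2
    omega

theorem isLocallyConstant_extend [CompactSpace α] [T2Space β] (h : IsTower T S G p) {φ : α → ℝ}
    (hφ : IsLocallyConstant φ) : IsLocallyConstant (Function.extend G φ 0) := by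
  rw [IsLocallyConstant.iff_eventually_eq]
  intro y
  by_cases hy : y ∈ Set.range G
  · obtain ⟨x, rfl⟩ := hy
    rw [← h.isOpenEmbedding_base.map_nhds_eq, Filter.eventually_map]
    filter_upwards [hφ.eventually_eq x] with x' hx'
    rwa [h.base_injective.extend_apply, h.base_injective.extend_apply]
  · have hcl : IsClosed (Set.range G) :=
      (h.continuous_base.isClosedEmbedding h.base_injective).isClosed_range
    filter_upwards [hcl.isOpen_compl.mem_nhds hy] with y' hy'
    rw [Function.extend_apply' _ _ _ hy, Function.extend_apply' _ _ _ hy']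
    rfl

theorem birkhoffSum_extend (h : IsTower T S G p) (φ : α → ℝ) (x : α) :
    birkhoffSum S (Function.extend G φ 0) (p x) (G x) = φ x := by
  rw [birkhoffSum, Finset.sum_eq_single_of_mem 0 (Finset.mem_range.2 (h.height_pos x))]
  · exact h.base_injective.extend_apply _ _ _
  · intro j hj hj0
    refine Function.extend_apply' _ _ _ ?_
    rintro ⟨x', hx'⟩
    exact hj0 (h.unique x' x 0 j (h.height_pos x') (Finset.mem_range.1 hj) hx').2.symm

/-- Extending `φ` by zero off the base makes its column sums equal to `φ`, so `φ - a * p` has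
bounded sums for some `a`. The constant 1 similarly yields `1 - c * p` with `c ≠ 0`, and eliminating
`p` leaves `φ - a / c`. -/
theorem isTotallyBalancedMap_base [CompactSpace α] [T2Space β] [Nonempty α]
    (h : IsTower T S G p) (hS : IsTotallyBalancedMap S) : IsTotallyBalancedMap T := by
  have key (φ : α → ℝ) (hφ : IsLocallyConstant φ) :
      ∃ a : ℝ, HasBoundedSums T fun x => φ x - a * p x := by
    obtain ⟨a, ha⟩ := hS _ (h.isLocallyConstant_extend hφ)
    refine ⟨a, ?_⟩
    convert h.hasBoundedSums_base ha using 2 with x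
    rw [birkhoffSum_sub_const, h.birkhoffSum_extend, mul_comm]
  intro φ hφ
  obtain ⟨a, ha⟩ := key φ hφ
  obtain ⟨c, hc⟩ := key (fun _ => 1) (IsLocallyConstant.const 1)
  have hc0 : c ≠ 0 := by
    rintro rfl
    simp only [zero_mul] at hc
    exact lt_irrefl _ (hc.pos_of_le (φ := fun _ => 1) one_pos fun _ => le_rfl)
  refine ⟨a / c, ?_⟩
  convert ha.add (hc.const_mul (-(a / c))) using 2
  field_simp
  ring

theorem isMinimalMap (h : IsTower T S G p) (hT : IsMinimalMap T) : IsMinimalMap S := by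
  intro Z hZ hne hinv
  have hiter (n : ℕ) (y : β) : S^[n] y ∈ Z ↔ y ∈ Z := by
    induction n with
    | zero => rfl
    | succ n ih => rw [Function.iterate_succ_apply', hinv, ih]
  have hG := hT (G ⁻¹' Z) (hZ.preimage h.continuous_base)
    (by
      obtain ⟨y, hy⟩ := hne
      obtain ⟨x, j, -, rfl⟩ := h.exists_eq y
      exact ⟨x, (hiter j _).1 hy⟩)
    fun x => by rw [Set.mem_preimage, h.map_base, hiter, Set.mem_preimage]
  refine Set.eq_univ_of_forall fun y => ?_
  obtain ⟨x, j, -, rfl⟩ := h.exists_eq y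
  exact (hiter j _).2 (hG.ge (Set.mem_univ x))

/-- The columns over a closed invariant `Z` form a closed set `D Z`. The columns over `Zᶜ` form its
complement, and both are forward invariant, so `D Z` is invariant under `S` in the two-sided sense.
-/
theorem isMinimalMap_base [CompactSpace α] [T2Space β] (h : IsTower T S G p)
    (hS : IsMinimalMap S) : IsMinimalMap T := by
  intro Z hZ hne hinv
  let D (W : Set α) : Set β := {y | ∃ x ∈ W, ∃ j, 0 ≤ j ∧ j < p x ∧ S^[j] (G x) = y}
  have hfwd (W : Set α) (hW : ∀ x ∈ W, T x ∈ W) (y : β) (hy : y ∈ D W) : S y ∈ D W := by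
    obtain ⟨x, hx, j, -, hj, rfl⟩ := hy
    rcases (Nat.succ_le_of_lt hj).lt_or_eq with h1 | h1
    · exact ⟨x, hx, j + 1, Nat.zero_le _, h1, Function.iterate_succ_apply' _ _ _⟩
    · refine ⟨T x, hW x hx, 0, le_rfl, h.height_pos _, ?_⟩
      rw [Function.iterate_zero, id, h.map_base, ← h1, Nat.succ_eq_add_one,
        Function.iterate_succ_apply']
  have hcompl (y : β) : y ∈ D Zᶜ ↔ y ∉ D Z := by
    constructor
    · rintro ⟨x, hx, j, -, hj, rfl⟩ ⟨x', hx', j', -, hj', he⟩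
      exact hx ((h.unique x' x j' j hj' hj he).1 ▸ hx')
    · intro hy
      obtain ⟨x, j, hj, rfl⟩ := h.exists_eq y
      exact ⟨x, fun hx => hy ⟨x, hx, j, Nat.zero_le _, hj, rfl⟩, j, Nat.zero_le _, hj, rfl⟩
  have hD := hS (D Z) (h.isClosed_levels hZ 0)
    (by obtain ⟨x, hx⟩ := hne; exact ⟨G x, x, hx, 0, le_rfl, h.height_pos x, rfl⟩)
    fun y => by
      refine ⟨fun hy => ?_, hfwd Z (fun x => (hinv x).2) y⟩
      by_contra hn
      exact (hcompl _).1
        (hfwd Zᶜ (fun x hx hx' => hx ((hinv x).1 hx')) y ((hcompl y).2 hn)) hy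
  refine Set.eq_univ_of_forall fun x => ?_
  obtain ⟨x', hx', j, -, hj, he⟩ := hD.ge (Set.mem_univ (G x))
  exact (h.unique x' x j 0 hj (h.height_pos x) he).1 ▸ hx'

end IsTower

/-- The consecutive blocks of positive integer lengths `p i` cover the integers. -/
theorem exists_signedSum_le_lt_int {p : ℤ → ℕ} (hp : ∀ i, 0 < p i) (n : ℤ) :
    ∃ k, signedSum (fun i => (p i : ℤ)) k ≤ n ∧ n < signedSum (fun i => (p i : ℤ)) (k + 1) := by
  obtain ⟨k, h1, h2⟩ := exists_signedSum_le_lt (f := fun i => ((p i : ℤ) : ℝ)) one_pos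
    (fun i => by exact_mod_cast hp i) (n : ℝ)
  have hcast (k : ℤ) : signedSum (fun i => ((p i : ℤ) : ℝ)) k =
      ((signedSum (fun i => (p i : ℤ)) k : ℤ) : ℝ) :=
    (map_signedSum (Int.castAddHom ℝ) (fun i => (p i : ℤ)) k).symm
  rw [hcast] at h1 h2
  exact ⟨k, by exact_mod_cast h1, by exact_mod_cast h2⟩

namespace SequenceSpace

variable {X Y : SequenceSpace.{u}}

/-! ### Relabellings -/

theorem continuous_blockCode {A B : Type u} [TopologicalSpace A] [DiscreteTopology A] [Finite A]
    [TopologicalSpace B] (r : ℕ) (f : (Fin (2 * r + 1) → A) → B) : Continuous (blockCode r f) :=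
  continuous_pi fun _ => continuous_of_discreteTopology.comp
    (continuous_pi fun _ => continuous_apply _)

theorem blockCode_shift {A B : Type u} (r : ℕ) (f : (Fin (2 * r + 1) → A) → B) (n : ℤ)
    (x : ℤ → A) : blockCode r f (shift n x) = shift n (blockCode r f x) := by
  ext k
  simp only [blockCode, shift_apply]
  congr 1
  ext i
  congr 1
  ring

theorem IsRelabelling.exists_isTower (h : X.IsRelabelling Y) :
    ∃ G p, IsTower X.sigma Y.sigma G p := by
  obtain ⟨r, f, hf⟩ := h
  refine ⟨fun x => ⟨blockCode r f x.1, hf.mapsTo x.2⟩, fun _ => 1, ?_⟩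
  exact
    { continuous_map := continuous_sigma
      continuous_base := ((continuous_blockCode r f).comp continuous_subtype_val).subtype_mk _
      isLocallyConstant_height := IsLocallyConstant.const 1
      height_pos := fun _ => one_pos
      map_base := fun x => Subtype.ext (blockCode_shift r f 1 x.1)
      unique := by
        intro x x' j j' hj hj' he
        obtain rfl := Nat.lt_one_iff.1 hj
        obtain rfl := Nat.lt_one_iff.1 hj'
        exact ⟨Subtype.ext (hf.injOn x.2 x'.2 (congrArg Subtype.val he)), rfl⟩
      exists_eq := by
        intro y
        obtain ⟨x, hx, he⟩ := hf.surjOn y.2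
        exact ⟨⟨x, hx⟩, 0, one_pos, Subtype.ext he⟩ }

/-! ### Divisions -/

/-- The place in the divided sequence of the first piece of the `k`-th tile of `x`. -/
noncomputable def place (X : SequenceSpace.{u}) (p : X.Alphabet → ℕ) (x : X.seqs) (k : ℤ) : ℤ :=
  signedSum (fun i => (p (x.1 i) : ℤ)) k

section Place

variable {p : X.Alphabet → ℕ}

@[simp] theorem place_zero (x : X.seqs) : X.place p x 0 = 0 := signedSum_zero _

theorem place_add_one (x : X.seqs) (k : ℤ) :
    X.place p x (k + 1) = X.place p x k + p (x.1 k) := signedSum_add_one _ _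

theorem place_shiftBy (x : X.seqs) (m k : ℤ) :
    X.place p (X.shiftBy m x) k = X.place p x (m + k) - X.place p x m := by
  simp only [place, shiftBy_apply, signedSum_add _ m k]; ring

theorem place_strictMono (hp : ∀ a, 0 < p a) (x : X.seqs) : StrictMono (X.place p x) :=
  strictMono_int_of_lt_succ fun k => by
    rw [place_add_one]
    have := hp (x.1 k)
    omega

theorem exists_place_le_lt (hp : ∀ a, 0 < p a) (x : X.seqs) (n : ℤ) :
    ∃ k, X.place p x k ≤ n ∧ n < X.place p x (k + 1) :=
  exists_signedSum_le_lt_int (fun i => hp (x.1 i)) n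

theorem place_eq_of_le_lt (hp : ∀ a, 0 < p a) (x : X.seqs) {n k k' : ℤ}
    (h1 : X.place p x k ≤ n) (h2 : n < X.place p x (k + 1))
    (h1' : X.place p x k' ≤ n) (h2' : n < X.place p x (k' + 1)) : k = k' := by
  have hm := place_strictMono hp x
  have e1 := hm.lt_iff_lt.1 (h1.trans_lt h2')
  have e2 := hm.lt_iff_lt.1 (h1'.trans_lt h2)
  omega

theorem continuous_place (k : ℤ) : Continuous fun x : X.seqs => X.place p x k := by
  have (i : ℤ) : Continuous fun x : X.seqs => (p (x.1 i) : ℤ) :=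
    (continuous_of_discreteTopology (f := fun a => (p a : ℤ))).comp (continuous_coord i)
  exact (continuous_finsetSum _ fun i _ => this i).sub (continuous_finsetSum _ fun i _ => this i)

end Place

/-- The sequence `y` is obtained from `x` by dividing tiles, and the first piece of the `0`-th tile
of `x` sits at place `0`. -/
def Divides {A : Type u} (p : X.Alphabet → ℕ) (e : (Σ a : X.Alphabet, Fin (p a)) → A) (x : X.seqs)
    (y : ℤ → A) : Prop :=
  ∀ (k : ℤ) (j : ℕ) (hj : j < p (x.1 k)), y (X.place p x k + j) = e ⟨x.1 k, j, hj⟩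

section Divides

variable {A : Type u} {p : X.Alphabet → ℕ} {e : (Σ a : X.Alphabet, Fin (p a)) → A}

theorem exists_divides (hp : ∀ a, 0 < p a) (x : X.seqs) : ∃ y, Divides p e x y := by
  choose κ h1 h2 using exists_place_le_lt (p := p) hp x
  refine ⟨fun n => e ⟨x.1 (κ n), (n - X.place p x (κ n)).toNat, ?_⟩, fun k j hj => ?_⟩
  · have := h2 n
    rw [place_add_one] at this
    have := h1 n
    omega
  · have hk : κ (X.place p x k + j) = k :=
      place_eq_of_le_lt hp x (h1 _) (h2 _) (by omega) (by rw [place_add_one]; omega)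
    have aux : ∀ (k' : ℤ) (i : ℕ) (hi : i < p (x.1 k')), k' = k → i = j →
        e ⟨x.1 k', i, hi⟩ = e ⟨x.1 k, j, hj⟩ := by
      rintro _ _ _ rfl rfl
      rfl
    exact aux _ _ _ hk (by rw [hk]; omega)

theorem exists_eq_place_add (hp : ∀ a, 0 < p a) (x : X.seqs) (n : ℤ) :
    ∃ (k : ℤ) (j : ℕ), j < p (x.1 k) ∧ n = X.place p x k + j := by
  obtain ⟨k, h1, h2⟩ := exists_place_le_lt hp x n
  rw [place_add_one] at h2
  exact ⟨k, (n - X.place p x k).toNat, by omega, by omega⟩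

theorem Divides.unique (hp : ∀ a, 0 < p a) {x : X.seqs} {y y' : ℤ → A} (h : Divides p e x y)
    (h' : Divides p e x y') : y = y' := by
  ext n
  obtain ⟨k, j, hj, rfl⟩ := exists_eq_place_add hp x n
  rw [h k j hj, h' k j hj]

theorem Divides.shift {x : X.seqs} {y : ℤ → A} (h : Divides p e x y) (m : ℤ) :
    Divides p e (X.shiftBy m x) (SymbolicDynamics.FullShift.shift (X.place p x m) y) := by
  intro k j hj
  rw [shift_apply, place_shiftBy]
  refine Eq.trans ?_ (h (m + k) j hj)
  congr 1
  ring

/-- The divided sequence determines the original one. -/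
theorem Divides.injective (hp : ∀ a, 0 < p a) (he : Function.Injective e) {x x' : X.seqs}
    {y : ℤ → A} (h : Divides p e x y) (h' : Divides p e x' y) : x = x' := by
  have hletter (k : ℤ) (hk : X.place p x k = X.place p x' k) : x.1 k = x'.1 k := by
    have h1 := h k 0 (hp _)
    rw [hk, h' k 0 (hp _)] at h1
    exact (congrArg Sigma.fst (he h1)).symm
  have hplace (k : ℤ) : X.place p x k = X.place p x' k := by
    induction k using Int.induction_on with
    | zero => simp
    | succ i ih => rw [place_add_one, place_add_one, ih, hletter _ ih]
    | pred i ih =>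
      -- Going backwards, the lengths of the preceding tiles are not yet known to agree, but their
      -- last pieces sit at the same place. The label of that piece determines the letter, hence the
      -- length.
      have e1 := place_add_one (p := p) x (-(i : ℤ) - 1)
      have e2 := place_add_one (p := p) x' (-(i : ℤ) - 1)
      rw [sub_add_cancel] at e1 e2
      have p1 := hp (x.1 (-(i : ℤ) - 1))
      have p2 := hp (x'.1 (-(i : ℤ) - 1))
      have h1 := h (-(i : ℤ) - 1) (p (x.1 (-(i : ℤ) - 1)) - 1) (by omega)
      have h2 := h' (-(i : ℤ) - 1) (p (x'.1 (-(i : ℤ) - 1)) - 1) (by omega)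
      rw [show X.place p x (-(i : ℤ) - 1) + ((p (x.1 (-(i : ℤ) - 1)) - 1 : ℕ) : ℤ) =
        X.place p x (-(i : ℤ)) - 1 by omega] at h1
      rw [show X.place p x' (-(i : ℤ) - 1) + ((p (x'.1 (-(i : ℤ) - 1)) - 1 : ℕ) : ℤ) =
        X.place p x (-(i : ℤ)) - 1 by omega, h1] at h2
      have h3 := congrArg Sigma.fst (he h2)
      dsimp only at h3
      rw [h3] at e1
      omega
  exact Subtype.ext (funext fun k => hletter k (hplace k))

end Divides

/-- The base consists of the divided sequences with a first piece at the origin. The column over `x`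
runs through the pieces of its tile `0`. -/
theorem IsDivision.exists_isTower (h : X.IsDivision Y) :
    ∃ G p, IsTower X.sigma Y.sigma G p := by
  obtain ⟨p, e, hp, he, hY⟩ := h
  choose g hg using exists_divides (e := e) hp
  have hmem (x : X.seqs) : g x ∈ Y.seqs := by
    rw [hY]
    exact ⟨x.1, x.2, X.place p x, place_add_one x, fun k j => hg x k j j.2⟩
  have hval (n : ℕ) (y : Y.seqs) : (Y.sigma^[n] y).1 = shift (n : ℤ) y.1 := by
    rw [sigma_iterate]; rfl
  refine ⟨fun x => ⟨g x, hmem x⟩, fun x => p (x.1 0), ?_⟩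
  exact
    { continuous_map := continuous_sigma
      continuous_base := by
        refine (continuous_pi fun n => ?_).subtype_mk _
        refine (IsLocallyConstant.iff_continuous _).1
          ((IsLocallyConstant.iff_eventually_eq _).2 fun x => ?_)
        -- The entry at place `n` is settled by the place and the letter of the tile `k` covering
        -- it, and both are locally constant in `x`.
        obtain ⟨k, j, hj, rfl⟩ := exists_eq_place_add hp x n
        have h1 := ((IsLocallyConstant.iff_continuous _).2
          (continuous_place (p := p) (X := X) k)).eventually_eq x
        have h2 := ((IsLocallyConstant.iff_continuous _).2
          (continuous_coord (X := X) k)).eventually_eq x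
        filter_upwards [h1, h2] with x' h1 h2
        have aux : ∀ (a : X.Alphabet) (ha : a = x.1 k) (hj' : j < p a),
            e ⟨a, j, hj'⟩ = e ⟨x.1 k, j, hj⟩ := by
          rintro _ rfl _
          rfl
        rw [hg x k j hj, ← h1, hg x' k j (h2 ▸ hj)]
        exact aux _ h2 _
      isLocallyConstant_height :=
        ((IsLocallyConstant.iff_continuous _).2 (continuous_coord (X := X) 0)).comp p
      height_pos := fun x => hp _
      map_base := by
        intro x
        refine Subtype.ext ?_
        rw [hval]
        refine (hg (X.sigma x)).unique hp ?_
        have := (hg x).shift 1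
        rwa [← zero_add (1 : ℤ), place_add_one, place_zero, zero_add, zero_add] at this
      unique := by
        intro x x' j j' hj hj' hjj
        have hv : shift (j : ℤ) (g x) = shift (j' : ℤ) (g x') := by
          have := congrArg Subtype.val hjj
          rwa [hval, hval] at this
        have h1 := hg x 0 j hj
        have h2 := hg x' 0 j' hj'
        have h0 := congrFun hv 0
        rw [place_zero, zero_add] at h1 h2
        rw [shift_apply, shift_apply, add_zero, add_zero] at h0
        rw [h1, h2] at h0
        have hS := he h0
        obtain rfl : j = j' := by
          have aux : ∀ s t : (Σ a : X.Alphabet, Fin (p a)), s = t → (s.2 : ℕ) = t.2 := by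
            rintro _ _ rfl
            rfl
          exact aux _ _ hS
        refine ⟨(hg x).injective hp he ?_, rfl⟩
        have : g x = g x' := by
          ext n
          have := congrFun hv (n - j)
          simpa using this
        rw [this]
        exact hg x'
      exists_eq := by
        intro y
        obtain ⟨x, hx, s, hs, hys⟩ := hY.le y.2
        have hplace (k : ℤ) : s k = s 0 + X.place p ⟨x, hx⟩ k := by
          have := signedSum_unique (f := fun i => (p (x i) : ℤ)) (s := fun k => s k - s 0)
            (by simp) (fun n => by rw [hs]; ring) k
          rw [place, ← this]
          ring
        -- The origin of `y` is place `-s 0` once the first piece of tile `0` is moved to place `0`;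
        -- `k` is the tile there and `j` the piece, hence the level.
        obtain ⟨k, j, hj, hk⟩ := exists_eq_place_add hp ⟨x, hx⟩ (-s 0)
        refine ⟨X.shiftBy k ⟨x, hx⟩, j, by simpa using hj, Subtype.ext ?_⟩
        rw [hval]
        have hd : Divides p e ⟨x, hx⟩ (shift (s 0) y.1) := by
          intro i l hl
          rw [shift_apply, ← add_assoc, ← hplace]
          exact hys i ⟨l, hl⟩
        have := (hg (X.shiftBy k ⟨x, hx⟩)).unique hp (hd.shift k)
        dsimp only
        rw [this, ← shift_add, ← shift_add]
        have h0 : s 0 + (X.place p ⟨x, hx⟩ k + (j : ℤ)) = 0 := by rw [← hk]; ring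
        rw [h0, shift_zero] }

/-! ### Total balance and locally constant functions -/

theorem continuous_letters (n : ℕ) : Continuous fun (x : X.seqs) (i : Fin n) => x.1 (i : ℕ) :=
  continuous_pi fun _ => continuous_coord _

theorem word_eq_ofFn (x : X.seqs) (n : ℕ) :
    X.word x n = List.ofFn fun i : Fin n => x.1 (i : ℕ) :=
  List.ext_getElem (by simp) fun _ _ _ => by simp [word]

theorem isLocallyConstant_reads (w : List X.Alphabet) : IsLocallyConstant (X.reads w) := by
  classical
  have h := ((IsLocallyConstant.iff_continuous _).2 (continuous_letters (X := X) w.length)).comp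
    fun v => if List.ofFn v = w then (1 : ℝ) else 0
  convert h using 1
  ext x
  simp [SequenceSpace.reads, word_eq_ofFn]

/-- A locally constant function only depends on finitely many letters. -/
theorem exists_finset_of_isLocallyConstant {φ : X.seqs → ℝ} (hφ : IsLocallyConstant φ) :
    ∃ I : Finset ℤ, ∀ x y : X.seqs, (∀ i ∈ I, x.1 i = y.1 i) → φ x = φ y := by
  have key (x : X.seqs) : ∃ I : Finset ℤ, ∀ y : X.seqs, (∀ i ∈ I, y.1 i = x.1 i) → φ y = φ x := by
    have h := hφ.eventually_eq x
    rw [nhds_subtype, Filter.eventually_comap, nhds_pi, Filter.Eventually, Filter.mem_pi'] at h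
    obtain ⟨I, t, ht, hsub⟩ := h
    exact ⟨I, fun y hy => hsub (fun i hi => by
      rw [hy i hi]; exact mem_of_mem_nhds (ht i)) y rfl⟩
  choose I hI using key
  -- Finitely many cylinders on which `φ` is constant cover the space; the union of their windows
  -- serves for all sequences.
  obtain ⟨F, hF⟩ := isCompact_univ.elim_finite_subcover
    (fun x : X.seqs => {y : X.seqs | ∀ i ∈ I x, y.1 i = x.1 i})
    (fun x => by
      have : {y : X.seqs | ∀ i ∈ I x, y.1 i = x.1 i} =
          Subtype.val ⁻¹' cylinder (I x) x.1 := rfl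
      rw [this]
      exact (isOpen_cylinder _ _).preimage continuous_subtype_val)
    (fun x _ => Set.mem_iUnion.2 ⟨x, fun _ _ => rfl⟩)
  classical
  refine ⟨F.biUnion I, fun x y hxy => ?_⟩
  obtain ⟨z, hz, hx⟩ := Set.mem_iUnion₂.1 (hF (Set.mem_univ x))
  rw [hI z x hx, hI z y fun i hi => ?_]
  rw [← hxy i (Finset.mem_biUnion.2 ⟨z, hz, hi⟩)]
  exact hx i hi

/-- A locally constant function depends on a window of radius `r`, so it is a linear combination of
indicators of words of length `2 * r + 1`, read from place `-r`. That displacement commutes with the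
shift and preserves bounded discrepancy. -/
theorem TotallyFinitelyBalanced.isTotallyBalancedMap (hX : X.TotallyFinitelyBalanced) :
    IsTotallyBalancedMap X.sigma := by
  classical
  intro φ hφ
  obtain ⟨I, hI⟩ := exists_finset_of_isLocallyConstant hφ
  obtain ⟨r, hr⟩ : ∃ r : ℕ, ∀ i ∈ I, |i| ≤ r :=
    ⟨I.sup Int.natAbs, fun i hi => by
      rw [Int.abs_eq_natAbs]; exact_mod_cast Finset.le_sup (f := Int.natAbs) hi⟩
  let m := 2 * r + 1
  let v (x : X.seqs) : List X.Alphabet := X.word (X.shiftBy (-r) x) m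
  have hv (x y : X.seqs) (h : v x = v y) : φ x = φ y := by
    refine hI x y fun i hi => ?_
    have hi' := abs_le.1 (hr i hi)
    simp only [v, word_eq_ofFn] at h
    have := congrFun (List.ofFn_injective h) ⟨(i + r).toNat, by omega⟩
    simp only [shiftBy_apply] at this
    rwa [show -(r : ℤ) + ((i + r).toNat : ℤ) = i by omega] at this
  have hfin : (Set.range v).Finite :=
    (List.finite_length_eq X.Alphabet m).subset (by rintro _ ⟨x, rfl⟩; exact length_word _ _)
  -- `Function.extend v φ 0 w` is the value of `φ` on sequences with window `w`, well defined by
  -- `hv`.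
  have hφ' : φ = fun x => ∑ w ∈ hfin.toFinset,
      Function.extend v φ 0 w * X.reads w (X.shiftBy (-r) x) := by
    ext x
    rw [Finset.sum_eq_single_of_mem (v x) (by simp)]
    · have h1 : Function.extend v φ 0 (v x) = φ x :=
        Function.FactorsThrough.extend_apply (fun x y h => hv x y h) 0 x
      rw [h1, SequenceSpace.reads, if_pos (by simp only [v, length_word]), mul_one]
    · intro w hw hne
      obtain ⟨y, rfl⟩ := hfin.mem_toFinset.1 hw
      rw [SequenceSpace.reads, if_neg, mul_zero]
      simp only [v, length_word] at hne ⊢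
      exact fun h => hne h.symm
  rw [hφ']
  refine HasBoundedDiscrepancy.sum _ fun w _ => HasBoundedDiscrepancy.const_mul ?_ _
  refine (hX.reads w).comp_semiconj (G := X.shiftBy (-r)) fun x => ?_
  simp only [sigma_eq_shiftBy, shiftBy_shiftBy, add_comm]

theorem isMinimal_iff_isMinimalMap : X.IsMinimal ↔ IsMinimalMap X.sigma := isMinimal_iff

/-- Minimality together with total balance is invariant under finite recodings. -/
theorem IsFiniteRecoding.minimal_and_balanced_iff (h : X.IsFiniteRecoding Y) :
    (IsMinimalMap X.sigma ∧ IsTotallyBalancedMap X.sigma) ↔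
      (IsMinimalMap Y.sigma ∧ IsTotallyBalancedMap Y.sigma) := by
  induction h with
  | rel X Y h =>
    obtain ⟨G, p, hG⟩ : ∃ G p, IsTower X.sigma Y.sigma G p :=
      h.elim IsRelabelling.exists_isTower IsDivision.exists_isTower
    exact ⟨fun h => ⟨hG.isMinimalMap h.1, hG.isTotallyBalancedMap h.2⟩,
      fun h => ⟨hG.isMinimalMap_base h.1, hG.isTotallyBalancedMap_base h.2⟩⟩
  | refl X => rfl
  | symm X Y _ ih => exact ih.symm
  | trans X Y Z _ _ ih1 ih2 => exact ih1.trans ih2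

theorem IsMinimal.isTotallyPlastic (hX : X.IsMinimal) (hbal : X.TotallyFinitelyBalanced) :
    X.IsTotallyPlastic := by
  intro Y hY
  obtain ⟨h1, h2⟩ := hY.minimal_and_balanced_iff.1
    ⟨isMinimal_iff_isMinimalMap.1 hX, hbal.isTotallyBalancedMap⟩
  exact (isMinimal_iff_isMinimalMap.2 h1).isPlastic
    (finitelyBalanced_iff.2 fun a => h2 _ (isLocallyConstant_reads [a]))

/-! ### Marking the occurrences of a word -/

/-- The image of a sequence space under a sliding block code. -/
def blockImage (X : SequenceSpace.{u}) {B : Type u} [TopologicalSpace B] [DiscreteTopology B]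
    [Finite B] (r : ℕ) (f : (Fin (2 * r + 1) → X.Alphabet) → B) : SequenceSpace.{u} where
  Alphabet := B
  toSubshift :=
    { carrier := blockCode r f '' X.seqs
      isClosed := (X.toSubshift.isClosed.isCompact.image (continuous_blockCode r f)).isClosed
      mapsTo := by
        rintro n _ ⟨x, hx, rfl⟩
        exact ⟨shift n x, X.toSubshift.mapsTo n hx, blockCode_shift r f n x⟩ }
  nonempty := X.nonempty.image _

theorem isRelabelling_blockImage {B : Type u} [TopologicalSpace B] [DiscreteTopology B]
    [Finite B] (r : ℕ) (f : (Fin (2 * r + 1) → X.Alphabet) → B)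
    (hf : Set.InjOn (blockCode r f) X.seqs) : X.IsRelabelling (X.blockImage r f) :=
  ⟨r, f, hf.bijOn_image⟩

open Classical in
/-- The local rule that moves a letter to the left copy of the alphabet if an occurrence of `w`
starts there, and to the right copy otherwise. -/
noncomputable def markRule (w : List X.Alphabet)
    (v : Fin (2 * w.length + 1) → X.Alphabet) : X.Alphabet ⊕ X.Alphabet :=
  -- The centre of the window has index `w.length`; the rule tests the word starting there and
  -- ignores the left half.
  if (List.ofFn fun i : Fin w.length => v ⟨w.length + i, by omega⟩) = w then
    Sum.inl (v ⟨w.length, by omega⟩)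
  else Sum.inr (v ⟨w.length, by omega⟩)

open Classical in
theorem blockCode_markRule (w : List X.Alphabet) (x : X.seqs) (n : ℤ) :
    blockCode w.length (markRule w) x.1 n =
      if X.word (X.shiftBy n x) w.length = w then Sum.inl (x.1 n) else Sum.inr (x.1 n) := by
  have h1 : (n - w.length + (w.length : ℕ) : ℤ) = n := by ring
  have h2 (i : ℕ) : n - (w.length : ℤ) + ((w.length + i : ℕ) : ℤ) = n + i := by push_cast; ring
  simp only [blockCode, markRule, word_eq_ofFn, h1, h2, shiftBy_apply]

/-- Marking is injective, since the mark can be erased, so the marked space is a recoding and hence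
plastic. There the indicator of an occurrence of `w` is a function of one letter. -/
theorem IsTotallyPlastic.totallyFinitelyBalanced (hX : X.IsTotallyPlastic) :
    X.TotallyFinitelyBalanced := by
  classical
  refine totallyFinitelyBalanced_iff.2 fun w _ => ?_
  let Y := X.blockImage w.length (markRule w)
  have hinj : Set.InjOn (blockCode w.length (markRule w)) X.seqs := by
    intro x hx y hy hxy
    ext n
    have := congrFun hxy n
    rw [blockCode_markRule w ⟨x, hx⟩, blockCode_markRule w ⟨y, hy⟩] at this
    split_ifs at this <;> simpa using this
  have hY : Y.IsPlastic := hX Y (.rel _ _ (.inl (isRelabelling_blockImage _ _ hinj)))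
  let φ : X.Alphabet ⊕ X.Alphabet → ℝ := Sum.elim (fun _ => 1) fun _ => 0
  let G (x : X.seqs) : Y.seqs := ⟨blockCode w.length (markRule w) x.1, x.1, x.2, rfl⟩
  convert (hY.hasBoundedDiscrepancy φ).comp_semiconj (T := X.sigma) (G := G)
    fun x => Subtype.ext (blockCode_shift w.length (markRule w) 1 x.1) using 1
  ext x
  have h0 := blockCode_markRule w x 0
  rw [shiftBy_zero] at h0
  change X.reads w x = φ (blockCode w.length (markRule w) x.1 0)
  rw [h0, SequenceSpace.reads]
  split_ifs <;> rfl

end SequenceSpace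

theorem theorem1p1 (Ξ : SequenceSpace.{u}) :
    ((Ξ.IsPlastic → Ξ.FinitelyBalanced) ∧
      (Ξ.IsTotallyPlastic → Ξ.TotallyFinitelyBalanced)) ∧
    (Ξ.IsMinimal →
      (Ξ.IsPlastic ↔ Ξ.FinitelyBalanced) ∧
      (Ξ.IsTotallyPlastic ↔ Ξ.TotallyFinitelyBalanced)) :=
  ⟨⟨fun h => h.finitelyBalanced, fun h => h.totallyFinitelyBalanced⟩, fun hmin =>
    ⟨⟨fun h => h.finitelyBalanced, hmin.isPlastic⟩,
      ⟨fun h => h.totallyFinitelyBalanced, hmin.isTotallyPlastic⟩⟩⟩
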